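/- **Setting.** Let $V$ be a finite-dimensional real vector space, $(\alpha_i)_{i\in I}$ ($I$ finite) a linearly independent family in $V^*$ and $(\alpha_i^\vee)_{i\in I}$ a family in $V$ with $\alpha_i(\alpha_i^\vee)=2$. Let $W^v\subset GL(V)$ be generated by the reflections $r_i(v)=v-\alpha_i(v)\alpha_i^\vee$ and let $\Phi=\{w\alpha_i\mid w\in W^v, i\in I\}$ be the set of real roots. Put $V^*_+=\sum_i\mathbb R_{\ge0}\alpha_i$ and $\Phi^+=\Phi\cap V^*_+$. It is assumed that $W^v$ is a Coxeter group for the generators $r_i$; that $r_\alpha=wr_iw^{-1}$ depends only on $\alpha=w\alpha_i$; that $\Phi=\Phi^+\sqcup-\Phi^+$; that only $1\in W^v$ stabilizes $\Phi^+$; that $w\alpha_i\in\Phi^+\iff\ell(wr_i)>\ell(w)$; and that $\Phi\cap\mathbb R_{\ge0}\alpha=\{\alpha\}$ for $\alpha\in\Phi$. A set $\Delta_{im}\subset V^*$ of imaginary roots is given, disjoint from $\mathbb R\Phi$, stable under $\pm W^v$, such that $\Delta_{im}\subset V^*_+\cup -V^*_+$ and $\Delta_{im}\cap V^*_+$ is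 $W^v$-stable (moderately imaginary case). Put $\Delta=\Phi\cup\Delta_{im}$. The vectorial facets are the sets $\pm wF^v(J)$ ($w\in W^v$, $J\subset I$), where $F^v(J)=\{v\mid \alpha_i(v)=0\ (i\in J),\ \alpha_i(v)>0\ (i\notin J)\}$; those with $J=\emptyset$ are the vectorial chambers, and those with $\langle r_i\mid i\in J\rangle$ finite are called spherical. The Tits cone $\mathcal T$ is the union of the facets $wF^v(J)$. The model apartment $\mathbb A$ is an affine space under $V$ with a set $\mathcal M$ of affine hyperplanes (walls) such that each wall has direction $\ker\alpha$ for some $\alpha\in\Phi$, each $\ker\alpha$ ($\alpha\in\Phi$) is the direction of infinitely many walls, and $\mathcal M$ is stable under the group $W$ generated by the reflections $r_M$ ($M\in\mathcal M$) with linear part $r_\alpha$, $\ker\alpha$ being the direction of $M$. Half-spaces of type $\alpha\in\Delta$ are the sets $\{y\mid\alpha(y-m)\ge0\}$ (closed) and $\{y\mid\alpha(y-m)>0\}$ (open), where, if $\alpha\in\Phi$, the hyperplane $m+\ker\alpha$ must be a wall, and, if $\alpha\in\Delta_{im}$, $m$ is arbitrary; the closed ones with $\alpha\in\Phi$ are the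 half-apartments of $\mathbb A$. Subsets are identified with principal filters. A set contains a filter if it is a member of it, the union of two filters is the filter of their common members, and a map fixes a filter if it fixes some member pointwise. The enclosure $cl(F)$ of a filter $F$ consists of the sets containing a member of $F$ of the form $\bigcap_{\alpha\in\Delta}H_\alpha$, each $H_\alpha$ being $\mathbb A$ or a closed half-space of type $\alpha$. The facet $F(x,F^v)$ is defined in the same way from the germ at $x$ of $x+F^v$, with closed or open half-spaces. The chimney with base a facet $F$ and direction a vectorial facet $F^v$ is $cl(F+F^v)$; it is splayed if $F^v$ is spherical, and solid if the direction of its support (the smallest affine subspace containing it) has a finite pointwise fixator in $W^v$. Its germ consists of the sets containing $cl(F+\xi+F^v)$ for some $\xi\in\overline{F^v}$. The sector germ of direction a vectorial chamber $C^v$ is the filter of the sets containing some $x+C^v$, $x\in\mathbb A$. A germ $]x,y)$ of an interval with $x\ne y$ is preordered if $y-x\in\pm\mathcal T$; a half-line is generic if its direction vectors lie in a spherical vectorial facet. An affine hovel of type $\mathbb A$ is a set $\mathcal I$ covered by a set of subsets (apartments) such that: - (MA1) each apartment $A$ is endowed with a nonempty set $\mathrm{Isom}(\mathbb A,A)$ of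 bijections $\mathbb A\to A$ of the form $\{f_0\circ w\mid w\in W\}$ (this transports all the notions above to $A$; an isomorphism $A\to A'$ is a bijection $\varphi$ such that $\varphi\circ f\in \mathrm{Isom}(\mathbb A,A')$ for $f\in \mathrm{Isom}(\mathbb A,A)$); - (MA2) if $F$ is a point, a germ of a preordered interval, a generic half-line or a solid chimney of an apartment $A$, and $A'$ is an apartment containing $F$, then $A\cap A'$ contains the enclosure $cl_A(F)$ and some isomorphism $A\to A'$ fixes $cl_A(F)$; - (MA3) if $\mathfrak R$ is the germ of a splayed chimney and $F$ is a facet or the germ of a solid chimney (each in some apartment), then some apartment contains $\mathfrak R$ and $F$; - (MA4) if two apartments $A,A'$ contain $\mathfrak R$ and $F$ as in (MA3), then $A\cap A'$ contains $cl_A(\mathfrak R\cup F)$ and some isomorphism $A\to A'$ fixes $cl_A(\mathfrak R\cup F)$. The retraction $\rho_{A,\mathfrak Q}$ of $\mathcal I$ onto an apartment $A$ with centre a sector germ $\mathfrak Q$ of $A$ is the map $\mathcal I\to A$, identity on $A$, with $\rho_{A,\mathfrak Q}(x)=\varphi(x)$ for every apartment $B$ containing $\mathfrak Q$ and $x$ and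 every isomorphism $\varphi:B\to A$ fixing $\mathfrak Q$ (such $B$ and $\varphi$ exist for each $x$). **Proposition.** Let $A_1$ and $A_2$ be two apartments of an affine hovel $\mathcal I$ such that $A_1\cap A_2$ is a half-apartment $D$ (of some apartment). Then there is a sector germ $\mathfrak Q$ of $A_1$ such that the retraction $\rho=\rho_{A_1,\mathfrak Q}$ exists and $\rho(A_2)=D$. -/

import Mathlib

open Filter Topology

noncomputable section

namespace Masure

/-! ### The vectorial data: simple roots, Weyl group, real and imaginary roots -/

/-- Simple roots (a free family in the dual) and simple coroots, indexed by the same set `ι`. -/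
structure RootBase (V : Type*) [AddCommGroup V] [Module ℝ V] (ι : Type*) where
  root : ι → Module.Dual ℝ V
  coroot : ι → V
  linearIndependent : LinearIndependent ℝ root
  root_coroot : ∀ i, root i (coroot i) = 2

/-- The action of `GL(V)` on the dual of `V`. -/
def dualAct {V : Type*} [AddCommGroup V] [Module ℝ V] (w : V ≃ₗ[ℝ] V)
    (f : Module.Dual ℝ V) : Module.Dual ℝ V :=
  f ∘ₗ (w.symm : V →ₗ[ℝ] V)

namespace RootBase

variable {V : Type*} [AddCommGroup V] [Module ℝ V] {ι : Type*} (B : RootBase V ι)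

/-- The simple reflection `v ↦ v - αᵢ(v) αᵢ^∨`. -/
def refl (i : ι) : V ≃ₗ[ℝ] V := Module.reflection (B.root_coroot i)

/-- The vectorial Weyl group `W^v`. -/
def weylGroup : Subgroup (V ≃ₗ[ℝ] V) := Subgroup.closure (Set.range B.refl)

/-- The parabolic subgroup `W^v(J)`. -/
def parabolic (J : Set ι) : Subgroup (V ≃ₗ[ℝ] V) := Subgroup.closure (B.refl '' J)

/-- The set `Φ` of real roots. -/
def realRoots : Set (Module.Dual ℝ V) :=
  {f | ∃ w ∈ B.weylGroup, ∃ i, f = dualAct w (B.root i)}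

/-- The cone of the nonnegative combinations of the simple roots. -/
def posCone [Fintype ι] : Set (Module.Dual ℝ V) :=
  {f | ∃ c : ι → ℝ, (∀ i, 0 ≤ c i) ∧ f = ∑ i, c i • B.root i}

/-- The set `Φ⁺` of positive real roots. -/
def posRoots [Fintype ι] : Set (Module.Dual ℝ V) := B.realRoots ∩ B.posCone

/-- The facet `F^v(J)` of the closed fundamental chamber. -/
def stdFacet (J : Set ι) : Set V :=
  {v | (∀ i ∈ J, B.root i v = 0) ∧ ∀ i, i ∉ J → 0 < B.root i v}

/-- `F` is a positive vectorial facet of type `J`. -/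
def IsPosFacetOfType (J : Set ι) (F : Set V) : Prop :=
  ∃ w ∈ B.weylGroup, F = (fun v => w v) '' B.stdFacet J

/-- `F` is a vectorial facet of type `J`, positive or negative. -/
def IsFacetOfType (J : Set ι) (F : Set V) : Prop :=
  B.IsPosFacetOfType J F ∨ B.IsPosFacetOfType J ((fun v => -v) '' F)

/-- Vectorial facets, of either sign. -/
def IsVFacet (F : Set V) : Prop := ∃ J, B.IsFacetOfType J F

/-- Spherical vectorial facets, of either sign. -/
def IsSphericalVFacet (F : Set V) : Prop :=
  ∃ J, Finite (B.parabolic J) ∧ B.IsFacetOfType J F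

/-- Vectorial chambers, of either sign. -/
def IsVChamber (C : Set V) : Prop := B.IsFacetOfType ∅ C

/-- The Tits cone: the union of the positive vectorial facets. -/
def titsCone : Set V := {v | ∃ J F, B.IsPosFacetOfType J F ∧ v ∈ F}

end RootBase

/-- A root base whose Weyl group is a Coxeter group with the usual properties of roots, together
with a set of imaginary roots, in the moderately imaginary case. -/
structure WeylDatum (V : Type*) [AddCommGroup V] [Module ℝ V] (ι : Type*) [Fintype ι]
    extends RootBase V ι where
  /-- `W^v` is a Coxeter group for the generators `rᵢ`; the entries of the Coxeter matrix
  are then the orders of the products `rᵢ rⱼ` (`0` standing for infinite order). -/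
  coxMatrix : CoxeterMatrix ι
  coxSystem : CoxeterSystem coxMatrix toRootBase.weylGroup
  coxSystem_simple : ∀ i, (coxSystem.simple i : V ≃ₗ[ℝ] V) = toRootBase.refl i
  /-- The reflection attached to a real root `w(αᵢ)` depends only on that root. -/
  refl_unique : ∀ w ∈ toRootBase.weylGroup, ∀ w' ∈ toRootBase.weylGroup, ∀ i j,
    dualAct w (root i) = dualAct w' (root j) →
      w * toRootBase.refl i * w⁻¹ = w' * toRootBase.refl j * w'⁻¹
  /-- Every real root is positive or negative. -/
  pos_or_neg : ∀ f ∈ toRootBase.realRoots, f ∈ toRootBase.posCone ∨ -f ∈ toRootBase.posCone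
  /-- Only the neutral element stabilizes `Φ⁺`. -/
  stabilizer_pos : ∀ w ∈ toRootBase.weylGroup,
    dualAct w '' toRootBase.posRoots = toRootBase.posRoots → w = 1
  length_lt_iff : ∀ (w : toRootBase.weylGroup) (i : ι),
    dualAct (w : V ≃ₗ[ℝ] V) (root i) ∈ toRootBase.posRoots ↔
      coxSystem.length w < coxSystem.length (w * coxSystem.simple i)
  /-- The root system is reduced. -/
  reduced : ∀ f ∈ toRootBase.realRoots, ∀ c : ℝ, 0 ≤ c → c • f ∈ toRootBase.realRoots → c • f = f
  /-- The set `Δ_im` of imaginary roots: disjoint from `ℝΦ` and stable by `± W^v`. -/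
  imRoots : Set (Module.Dual ℝ V)
  im_disjoint : ∀ f ∈ toRootBase.realRoots, ∀ c : ℝ, c • f ∉ imRoots
  im_neg : ∀ f ∈ imRoots, -f ∈ imRoots
  im_weyl : ∀ w ∈ toRootBase.weylGroup, ∀ f ∈ imRoots, dualAct w f ∈ imRoots
  /-- Moderately imaginary: an imaginary root is positive or negative, and the set of the
  positive ones is stable by `W^v`. -/
  im_pos_or_neg : ∀ f ∈ imRoots, f ∈ toRootBase.posCone ∨ -f ∈ toRootBase.posCone
  im_pos_weyl : ∀ w ∈ toRootBase.weylGroup, ∀ f ∈ imRoots, f ∈ toRootBase.posCone →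
    dualAct w f ∈ toRootBase.posCone

namespace WeylDatum

variable {V : Type*} [AddCommGroup V] [Module ℝ V] {ι : Type*} [Fintype ι]

/-- All roots, real or imaginary. -/
def allRoots (D : WeylDatum V ι) : Set (Module.Dual ℝ V) := D.realRoots ∪ D.imRoots

end WeylDatum

/-! ### The model apartment -/

section Affine

variable {V : Type*} [NormedAddCommGroup V] [NormedSpace ℝ V]
  {P : Type*} [AddTorsor V P] {ι : Type*} [Fintype ι]

/-- The affine hyperplane of direction `Ker f` through `m`. -/
def hyperplane (f : Module.Dual ℝ V) (m : P) : AffineSubspace ℝ P :=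
  AffineSubspace.mk' m (LinearMap.ker f)

/-- The closed half-space `{y | f (y - m) ≥ 0}`. -/
def closedHalf (f : Module.Dual ℝ V) (m : P) : Set P := {y | 0 ≤ f (y -ᵥ m)}

/-- The open half-space `{y | f (y - m) > 0}`. -/
def openHalf (f : Module.Dual ℝ V) (m : P) : Set P := {y | 0 < f (y -ᵥ m)}

/-- `g` is the reflection `r_M`: it fixes the hyperplane `M` pointwise and its linear part is the
reflection `w rᵢ w⁻¹` of a real root `w(αᵢ)` whose kernel is the direction of `M`. -/
def RootBase.IsWallReflection (B : RootBase V ι) (M : AffineSubspace ℝ P) (g : P ≃ᵃ[ℝ] P) : Prop :=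
  (∀ p ∈ M, g p = p) ∧ ∃ w ∈ B.weylGroup, ∃ i,
    M.direction = LinearMap.ker (dualAct w (B.root i)) ∧ g.linear = w * B.refl i * w⁻¹

/-- The group generated by the reflections along the members of a set of hyperplanes. -/
def RootBase.affineWeyl (B : RootBase V ι) (walls : Set (AffineSubspace ℝ P)) :
    Subgroup (P ≃ᵃ[ℝ] P) :=
  Subgroup.closure {g | ∃ M ∈ walls, B.IsWallReflection M g}

end Affine

/-- The model affine apartment: an affine space `P` under `V` with its set of real walls.
The imaginary walls are all the hyperplanes whose direction is the kernel of an imaginary root. -/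
structure ModelApartment (V : Type*) [NormedAddCommGroup V] [NormedSpace ℝ V]
    (P : Type*) [AddTorsor V P] (ι : Type*) [Fintype ι] extends WeylDatum V ι where
  walls : Set (AffineSubspace ℝ P)
  wall_direction : ∀ M ∈ walls, ∃ f ∈ toRootBase.realRoots, ∃ m : P, M = hyperplane f m
  infinite_walls : ∀ f ∈ toRootBase.realRoots,
    {M | M ∈ walls ∧ M.direction = LinearMap.ker f}.Infinite
  walls_stable : ∀ g ∈ toRootBase.affineWeyl walls, ∀ M ∈ walls,
    M.map (g : P →ᵃ[ℝ] P) ∈ walls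

namespace ModelApartment

variable {V : Type*} [NormedAddCommGroup V] [NormedSpace ℝ V]
  {P : Type*} [AddTorsor V P] {ι : Type*} [Fintype ι] (𝔸 : ModelApartment V P ι)

/-- The affine Weyl group `W`. -/
def weyl : Subgroup (P ≃ᵃ[ℝ] P) := 𝔸.toRootBase.affineWeyl 𝔸.walls

/-- The hyperplane of direction `Ker f` through `m` is a wall: a real wall if `f` is a real root,
any hyperplane if `f` is an imaginary root. -/
def IsWallAt (f : Module.Dual ℝ V) (m : P) : Prop :=
  (f ∈ 𝔸.realRoots ∧ hyperplane f m ∈ 𝔸.walls) ∨ f ∈ 𝔸.imRoots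

/-- The half-spaces `D(f, k)` with `k ∈ Γ_f ∪ {∞}`. -/
def closedHalves (f : Module.Dual ℝ V) : Set (Set P) :=
  {H | H = Set.univ ∨ ∃ m, 𝔸.IsWallAt f m ∧ H = closedHalf f m}

/-- The half-spaces `D(f, k)` or `D°(f, k)` with `k ∈ Γ_f ∪ {∞}`. -/
def anyHalves (f : Module.Dual ℝ V) : Set (Set P) :=
  {H | H = Set.univ ∨ ∃ m, 𝔸.IsWallAt f m ∧ (H = closedHalf f m ∨ H = openHalf f m)}

/-- `T` is an intersection of members of the families `h f`, one for each root `f`. -/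
def IsInter (h : Module.Dual ℝ V → Set (Set P)) (T : Set P) : Prop :=
  ∃ k : Module.Dual ℝ V → Set P, (∀ f ∈ 𝔸.allRoots, k f ∈ h f) ∧ T = ⋂ f ∈ 𝔸.allRoots, k f

theorem inter_mem_anyHalves (f : Module.Dual ℝ V) {H K : Set P}
    (hH : H ∈ 𝔸.anyHalves f) (hK : K ∈ 𝔸.anyHalves f) : H ∩ K = H ∨ H ∩ K = K := by
  rw [Set.inter_eq_left, Set.inter_eq_right]
  rcases hH with rfl | ⟨m, -, hH⟩
  · exact Or.inr (Set.subset_univ _)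
  rcases hK with rfl | ⟨n, -, hK⟩
  · exact Or.inl (Set.subset_univ _)
  have key : ∀ y : P, f (y -ᵥ m) = f (y -ᵥ n) + f (n -ᵥ m) := fun y => by
    rw [← map_add, vsub_add_vsub_cancel]
  rcases lt_trichotomy (f (n -ᵥ m)) 0 with h | h | h
  · left
    rcases hH with rfl | rfl <;> rcases hK with rfl | rfl <;> intro y hy <;>
      simp only [closedHalf, openHalf, Set.mem_ofPred_eq] at hy ⊢ <;>
      linarith [key y]
  · rcases hH with rfl | rfl
    · right
      rcases hK with rfl | rfl <;> intro y hy <;>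
        simp only [closedHalf, openHalf, Set.mem_ofPred_eq] at hy ⊢ <;>
      linarith [key y]
    · left
      rcases hK with rfl | rfl <;> intro y hy <;>
        simp only [closedHalf, openHalf, Set.mem_ofPred_eq] at hy ⊢ <;>
      linarith [key y]
  · right
    rcases hH with rfl | rfl <;> rcases hK with rfl | rfl <;> intro y hy <;>
      simp only [closedHalf, openHalf, Set.mem_ofPred_eq] at hy ⊢ <;>
      linarith [key y]

theorem closedHalves_subset (f : Module.Dual ℝ V) : 𝔸.closedHalves f ⊆ 𝔸.anyHalves f := by
  rintro H (h | ⟨m, hm, h⟩)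
  · exact Or.inl h
  · exact Or.inr ⟨m, hm, Or.inl h⟩

/-- The filter of the sets containing a member of `F` that is an intersection of members of the
families `h f`, one for each root `f`. -/
def hull (h : Module.Dual ℝ V → Set (Set P)) (h₀ : ∀ f, Set.univ ∈ h f)
    (h₁ : ∀ f, h f ⊆ 𝔸.anyHalves f) (F : Filter P) : Filter P where
  sets := {S | ∃ T ∈ F, 𝔸.IsInter h T ∧ T ⊆ S}
  univ_sets := ⟨Set.univ, univ_mem, ⟨fun _ => Set.univ, fun f _ => h₀ f, by simp⟩, subset_rfl⟩
  sets_of_superset := by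
    rintro S S' ⟨T, hT, hi, hs⟩ hss
    exact ⟨T, hT, hi, hs.trans hss⟩
  inter_sets := by
    rintro S S' ⟨T, hT, ⟨k, hk, rfl⟩, hs⟩ ⟨T', hT', ⟨k', hk', rfl⟩, hs'⟩
    refine ⟨_, inter_mem hT hT', ⟨fun f => k f ∩ k' f, fun f hf => ?_, ?_⟩,
      Set.inter_subset_inter hs hs'⟩
    · rcases 𝔸.inter_mem_anyHalves f (h₁ f (hk f hf)) (h₁ f (hk' f hf)) with e | e
      · exact (congrArg (· ∈ h f) e).mpr (hk f hf)
      · exact (congrArg (· ∈ h f) e).mpr (hk' f hf)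
    · simp only [Set.iInter_inter_distrib]

/-- The enclosure `cl(F)` of a filter. -/
def enclosure (F : Filter P) : Filter P :=
  𝔸.hull 𝔸.closedHalves (fun _ => Or.inl rfl) 𝔸.closedHalves_subset F

/-- The local facet `F^ℓ(x, F^v)`: the germ at `x` of `x + F^v`. -/
def localFacet (x : P) (Fv : Set V) : Filter P := map (fun v => v +ᵥ x) (𝓝[Fv] 0)

/-- The facet `F(x, F^v)`. -/
def facet (x : P) (Fv : Set V) : Filter P :=
  𝔸.hull 𝔸.anyHalves (fun _ => Or.inl rfl) (fun _ => subset_rfl) (localFacet x Fv)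

/-- The filter of the sets containing `S + E` for some `S ∈ F`. -/
def addSet (F : Filter P) (E : Set V) : Filter P :=
  map (fun q : V × P => q.1 +ᵥ q.2) (𝓟 E ×ˢ F)

/-- The chimney `r(F, F^v) = cl(F + F^v)` of base `F` and direction `F^v`. -/
def chimney (F : Filter P) (Fv : Set V) : Filter P := 𝔸.enclosure (addSet F Fv)

/-- The germ of the chimney `r(F, F^v)`: the sets containing one of its shortenings
`cl(F + ξ + F^v)`, with `ξ` in the closure of `F^v` (these shortenings are a filtering decreasing
family). -/
def chimneyGerm (F : Filter P) (Fv : Set V) : Filter P :=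
  ⨅ ξ ∈ closure Fv, 𝔸.enclosure (addSet (map (fun p => ξ +ᵥ p) F) Fv)

/-- The support of a filter: the smallest affine subspace that belongs to it. -/
def support (F : Filter P) : AffineSubspace ℝ P := sInf {E | (E : Set P) ∈ F}

/-- Solidity of a chimney: the direction of its support has a finite fixator in `W^v`. -/
def IsSolid (F : Filter P) : Prop :=
  {w : V ≃ₗ[ℝ] V | w ∈ 𝔸.weylGroup ∧ ∀ v ∈ (support F).direction, w v = v}.Finite

/-- Points, seen as filters. -/
def IsPoint (F : Filter P) : Prop := ∃ x : P, F = pure x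

/-- Germs `]x, x + v)` of preordered intervals. -/
def IsPreorderedIntervalGerm (F : Filter P) : Prop :=
  ∃ (x : P) (v : V), v ≠ 0 ∧ (v ∈ 𝔸.titsCone ∨ -v ∈ 𝔸.titsCone) ∧
    F = map (fun t : ℝ => t • v +ᵥ x) (𝓝[>] 0)

/-- Generic half-lines: the vectorial facet of a direction vector is spherical. -/
def IsGenericHalfLine (F : Filter P) : Prop :=
  ∃ (x : P) (v : V), v ≠ 0 ∧ (∃ Fv, 𝔸.IsSphericalVFacet Fv ∧ v ∈ Fv) ∧
    F = 𝓟 ((fun t : ℝ => t • v +ᵥ x) '' Set.Ici 0)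

/-- Solid chimneys. -/
def IsSolidChimney (F : Filter P) : Prop :=
  ∃ (x : P) (F₀ Fv : Set V), 𝔸.IsVFacet F₀ ∧ 𝔸.IsVFacet Fv ∧
    F = 𝔸.chimney (𝔸.facet x F₀) Fv ∧ 𝔸.IsSolid F

/-- Facets. -/
def IsFacet (F : Filter P) : Prop := ∃ (x : P) (Fv : Set V), 𝔸.IsVFacet Fv ∧ F = 𝔸.facet x Fv

/-- Germs of solid chimneys. -/
def IsSolidChimneyGerm (F : Filter P) : Prop :=
  ∃ (x : P) (F₀ Fv : Set V), 𝔸.IsVFacet F₀ ∧ 𝔸.IsVFacet Fv ∧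
    𝔸.IsSolid (𝔸.chimney (𝔸.facet x F₀) Fv) ∧ F = 𝔸.chimneyGerm (𝔸.facet x F₀) Fv

/-- Germs of splayed chimneys: those whose direction is spherical. -/
def IsSplayedChimneyGerm (F : Filter P) : Prop :=
  ∃ (x : P) (F₀ Fv : Set V), 𝔸.IsVFacet F₀ ∧ 𝔸.IsSphericalVFacet Fv ∧
    F = 𝔸.chimneyGerm (𝔸.facet x F₀) Fv

/-- Germs of sectors: for a vectorial chamber `C`, the sets containing a translate `x + C`
(the intersection of two sectors of direction `C` contains a third one). -/
def IsSectorGerm (F : Filter P) : Prop :=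
  ∃ C : Set V, 𝔸.IsVChamber C ∧ F = ⨅ x : P, 𝓟 ((fun v => v +ᵥ x) '' C)

/-- Half-apartments of the model: `D(f, k)` for a real root `f` and a real wall. -/
def IsHalfApartment (D : Set P) : Prop :=
  ∃ f ∈ 𝔸.realRoots, ∃ m : P, hyperplane f m ∈ 𝔸.walls ∧ D = closedHalf f m

end ModelApartment

/-! ### Affine hovels

A filter on `X` is contained in a set `A` when `A` belongs to it; it is contained in a filter `G`
when it is `≤ G`; the union of two filters is their supremum. A map fixes a filter when it fixes
pointwise a member of it. -/

/-- A set `X` covered by apartments of type `𝔸`. An apartment `A` comes with its set `isom A` of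
isomorphisms from the model, bijections from `P` onto `A` that form one orbit of `W`. -/
structure ApartmentSystem {V : Type*} [NormedAddCommGroup V] [NormedSpace ℝ V]
    {P : Type*} [AddTorsor V P] {ι : Type*} [Fintype ι] (𝔸 : ModelApartment V P ι)
    (X : Type*) where
  apartments : Set (Set X)
  cover : ⋃₀ apartments = Set.univ
  isom : Set X → Set (P → X)
  isom_nonempty : ∀ A ∈ apartments, (isom A).Nonempty
  isom_bijOn : ∀ A ∈ apartments, ∀ f ∈ isom A, Set.BijOn f Set.univ A
  isom_iff : ∀ A ∈ apartments, ∀ f₀ ∈ isom A, ∀ f : P → X,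
    f ∈ isom A ↔ ∃ w ∈ 𝔸.weyl, f = f₀ ∘ w

namespace ApartmentSystem

variable {V : Type*} [NormedAddCommGroup V] [NormedSpace ℝ V]
  {P : Type*} [AddTorsor V P] {ι : Type*} [Fintype ι] {𝔸 : ModelApartment V P ι}
  {X : Type*} (S : ApartmentSystem 𝔸 X)

/-- `φ` restricts to an isomorphism from the apartment `A` onto the apartment `A'`
(its values outside `A` are irrelevant). -/
def IsIso (A A' : Set X) (φ : X → X) : Prop := ∃ f ∈ S.isom A, φ ∘ f ∈ S.isom A'

/-- `F` is, in the apartment `A`, a filter of the kind `K`. -/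
def IsIn (K : Filter P → Prop) (A : Set X) (F : Filter X) : Prop :=
  ∃ f ∈ S.isom A, ∃ G, K G ∧ F = map f G

/-- `F` is a filter of the kind `K` in some apartment. -/
def Is (K : Filter P → Prop) (F : Filter X) : Prop := ∃ A ∈ S.apartments, S.IsIn K A F

/-- The intersection of `A` and `A'` contains the enclosure `cl_A(F)` of `F` in `A`, and there is
an isomorphism from `A` onto `A'` fixing this enclosure. -/
def EnclosureShared (A A' : Set X) (F : Filter X) : Prop :=
  ∀ f ∈ S.isom A, A ∩ A' ∈ map f (𝔸.enclosure (comap f F)) ∧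
    ∃ φ, S.IsIso A A' φ ∧ ∀ᶠ x in map f (𝔸.enclosure (comap f F)), φ x = x

/-- The axioms of an affine hovel, for a covering by apartments of type `𝔸`. -/
structure IsAffineHovel : Prop where
  ma2 : ∀ A ∈ S.apartments, ∀ A' ∈ S.apartments, ∀ F : Filter X,
    (S.IsIn ModelApartment.IsPoint A F ∨ S.IsIn 𝔸.IsPreorderedIntervalGerm A F ∨
      S.IsIn 𝔸.IsGenericHalfLine A F ∨ S.IsIn 𝔸.IsSolidChimney A F) →
    A' ∈ F → S.EnclosureShared A A' F
  ma3 : ∀ R F : Filter X, S.Is 𝔸.IsSplayedChimneyGerm R →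
    (S.Is 𝔸.IsFacet F ∨ S.Is 𝔸.IsSolidChimneyGerm F) →
    ∃ A ∈ S.apartments, A ∈ R ∧ A ∈ F
  ma4 : ∀ R F : Filter X, S.Is 𝔸.IsSplayedChimneyGerm R →
    (S.Is 𝔸.IsFacet F ∨ S.Is 𝔸.IsSolidChimneyGerm F) →
    ∀ A ∈ S.apartments, ∀ A' ∈ S.apartments, A ∈ R → A ∈ F → A' ∈ R → A' ∈ F →
    S.EnclosureShared A A' (R ⊔ F)

/-- Half-apartments of `X`. -/
def IsHalfApartment (D : Set X) : Prop :=
  ∃ A ∈ S.apartments, ∃ f ∈ S.isom A, ∃ H : Set P, 𝔸.IsHalfApartment H ∧ D = f '' H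

/-- `ρ` is the retraction of `X` onto the apartment `A` with centre the filter `R`: the image of `x`
is `φ x` for every apartment `B` containing `R` and `x` and every isomorphism `φ` from `B` onto
`A` fixing `R`, and there are such `B` and `φ`. -/
structure IsRetraction (A : Set X) (R : Filter X) (ρ : X → X) : Prop where
  mem : ∀ x, ρ x ∈ A
  eq_self : ∀ x ∈ A, ρ x = x
  exists_iso : ∀ x, ∃ B ∈ S.apartments, x ∈ B ∧ B ∈ R ∧
    ∃ φ, S.IsIso B A φ ∧ ∀ᶠ y in R, φ y = y
  eq_iso : ∀ x, ∀ B ∈ S.apartments, x ∈ B → B ∈ R →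
    ∀ φ, S.IsIso B A φ → (∀ᶠ y in R, φ y = y) → ρ x = φ x

end ApartmentSystem

end Masure

end

/-!
Write `A₁` and `A₂` as images of charts `f₁`, `f₂` of the model that agree exactly on the half-space
`w αᵢ (p - m) ≥ 0`, and let `𝔔` be the germ in `A₁` of the sectors of direction `w rᵢ C`, where `C`
is the fundamental chamber: it lies on the other side of the wall. For `p` on that other side, the
claim is that some chart `g` agreeing with `f₁` near `𝔔` satisfies `f₂ p = g (r p)`, with `r` the
reflection in the wall. Then `ρ (f₂ p) = f₁ (r p)` is in `D`, and `ρ` is the identity on `D`.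

The claim is proved simultaneously for all `p` of the cone `m - w C̄` (moving `m` in the wall) with
`w αᵢ (p - m) ≥ t`. It holds for `t = 0`, and the set of such `t` is an upper set of `ℝ`, so it is
enough that this set is stable under decreasing limits and under small decrease. For both, (MA3)
gives an apartment containing `𝔔` and the germ of a chimney of `A₂` of direction `-w F({i})`, based
at level `t` at a chamber pointing up or down, and (MA4) shows that it contains the required part of
`A₂`. The change of charts fixes a panel pointwise, so it is `1` or `r`, and `1` is excluded because
`f₁` and `f₂` differ beyond the wall.
-/

noncomputable section

namespace Masure

/-! ### Roots and vectorial facets -/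

section Vectorial

variable {V : Type*} [AddCommGroup V] [Module ℝ V] {ι : Type*}

theorem dualAct_apply (w : V ≃ₗ[ℝ] V) (f : Module.Dual ℝ V) (v : V) :
    dualAct w f v = f (w⁻¹ v) := rfl

theorem dualAct_mul (w w' : V ≃ₗ[ℝ] V) (f : Module.Dual ℝ V) :
    dualAct (w * w') f = dualAct w (dualAct w' f) := rfl

theorem dualAct_one (f : Module.Dual ℝ V) : dualAct (1 : V ≃ₗ[ℝ] V) f = f := rfl

theorem dualAct_dualAct_inv (w : V ≃ₗ[ℝ] V) (f : Module.Dual ℝ V) :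
    dualAct w (dualAct w⁻¹ f) = f := by
  rw [← dualAct_mul, mul_inv_cancel, dualAct_one]

theorem dualAct_inv_dualAct (w : V ≃ₗ[ℝ] V) (f : Module.Dual ℝ V) :
    dualAct w⁻¹ (dualAct w f) = f := by
  rw [← dualAct_mul, inv_mul_cancel, dualAct_one]

theorem dualAct_neg (w : V ≃ₗ[ℝ] V) (f : Module.Dual ℝ V) : dualAct w (-f) = -dualAct w f := rfl

theorem dualAct_sum_smul [Fintype ι] (w : V ≃ₗ[ℝ] V) (c : ι → ℝ) (f : ι → Module.Dual ℝ V) :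
    dualAct w (∑ j, c j • f j) = ∑ j, c j • dualAct w (f j) := by
  ext v
  simp [dualAct_apply]

/-- The relatively open face of type `J` of the cone where all the forms `γ j` are nonnegative.
For the transforms `γ` of the simple roots by `w ∈ W^v` it is the vectorial facet `w F^v(J)`, and
for their opposites it is `-w F^v(J)`. -/
def facetCone (γ : ι → Module.Dual ℝ V) (J : Set ι) : Set V :=
  {v | (∀ j ∈ J, γ j v = 0) ∧ ∀ j, j ∉ J → 0 < γ j v}

section FacetCone

variable {γ : ι → Module.Dual ℝ V} {J : Set ι} {v v' : V}

theorem facetCone_nonneg (hv : v ∈ facetCone γ J) (j : ι) : 0 ≤ γ j v := by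
  by_cases hj : j ∈ J
  · exact (hv.1 j hj).ge
  · exact (hv.2 j hj).le

theorem smul_mem_facetCone (hv : v ∈ facetCone γ J) {t : ℝ} (ht : 0 < t) :
    t • v ∈ facetCone γ J :=
  ⟨fun j hj => by simp [hv.1 j hj], fun j hj => by simpa using mul_pos ht (hv.2 j hj)⟩

theorem add_mem_facetCone (hv : v ∈ facetCone γ J) (hv' : ∀ j ∈ J, γ j v' = 0)
    (hv'' : ∀ j, 0 ≤ γ j v') : v + v' ∈ facetCone γ J :=
  ⟨fun j hj => by simp [hv.1 j hj, hv' j hj],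
    fun j hj => by simpa using add_pos_of_pos_of_nonneg (hv.2 j hj) (hv'' j)⟩

theorem neg_mem_facetCone : -v ∈ facetCone (-γ) J ↔ v ∈ facetCone γ J := by
  simp [facetCone]

theorem exists_dual_apply_eq [FiniteDimensional ℝ V] (hγ : LinearIndependent ℝ γ) (a : ι → ℝ) :
    ∃ v, ∀ j, γ j v = a j := by
  obtain ⟨φ, hφ⟩ := LinearMap.exists_extend ((Module.Basis.span hγ).constr ℝ a)
  refine ⟨(Module.evalEquiv ℝ V).symm φ, fun j => ?_⟩
  rw [Module.apply_evalEquiv_symm_apply, ← (Module.Basis.span hγ).constr_basis ℝ a j, ← hφ]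
  simp [Module.Basis.span_apply]

theorem facetCone_nonempty [FiniteDimensional ℝ V] (hγ : LinearIndependent ℝ γ) (J : Set ι) :
    (facetCone γ J).Nonempty := by
  classical
  obtain ⟨v, hv⟩ := exists_dual_apply_eq hγ fun j => if j ∈ J then 0 else 1
  exact ⟨v, fun j hj => by simp [hv, hj], fun j hj => by simp [hv, hj]⟩

theorem eq_smul_of_sum_apply_eq_zero [Fintype ι] {c : ι → ℝ} (hc : ∀ j, 0 ≤ c j) {i : ι}
    (hv : v ∈ facetCone γ {i}) (h : (∑ j, c j • γ j) v = 0) : ∑ j, c j • γ j = c i • γ i := by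
  refine Finset.sum_eq_single i (fun j _ hj => ?_) (by simp)
  have hterm : c j * γ j v = 0 :=
    (Finset.sum_eq_zero_iff_of_nonneg fun k _ => mul_nonneg (hc k) (facetCone_nonneg hv k)).1
      (by simpa [LinearMap.sum_apply] using h) j (Finset.mem_univ j)
  rw [(mul_eq_zero.1 hterm).resolve_right (hv.2 j hj).ne', zero_smul]

end FacetCone

namespace RootBase

variable (B : RootBase V ι)

/-- The simple roots transformed by `w`: they are the forms defining the chamber `w F^v(∅)`. -/
def simple (w : V ≃ₗ[ℝ] V) (j : ι) : Module.Dual ℝ V := dualAct w (B.root j)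

/-- The chamber `w F^v(∅)`. -/
abbrev chamber (w : V ≃ₗ[ℝ] V) : Set V := facetCone (B.simple w) ∅

/-- The panel `w F^v({i})`. -/
abbrev panel (w : V ≃ₗ[ℝ] V) (i : ι) : Set V := facetCone (B.simple w) {i}

/-- The panel `-w F^v({i})`. -/
abbrev oppositePanel (w : V ≃ₗ[ℝ] V) (i : ι) : Set V := facetCone (-B.simple w) {i}

/-- The reflection `r_α` of the real root `α = w αᵢ`. -/
def rootRefl (w : V ≃ₗ[ℝ] V) (i : ι) : V ≃ₗ[ℝ] V := w * B.refl i * w⁻¹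

theorem simple_linearIndependent (w : V ≃ₗ[ℝ] V) : LinearIndependent ℝ (B.simple w) :=
  B.linearIndependent.map' (LinearEquiv.dualMap w.symm).toLinearMap (LinearEquiv.ker _)

theorem image_stdFacet (w : V ≃ₗ[ℝ] V) (J : Set ι) :
    (fun v => w v) '' B.stdFacet J = facetCone (B.simple w) J := by
  ext v
  constructor
  · rintro ⟨u, hu, rfl⟩
    simpa [facetCone, simple, dualAct_apply, RootBase.stdFacet] using hu
  · intro hv
    exact ⟨w⁻¹ v, hv, by simp⟩

theorem isFacetOfType_facetCone {w : V ≃ₗ[ℝ] V} (hw : w ∈ B.weylGroup) (J : Set ι) :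
    B.IsFacetOfType J (facetCone (B.simple w) J) :=
  Or.inl ⟨w, hw, (B.image_stdFacet w J).symm⟩

theorem isFacetOfType_facetCone_neg {w : V ≃ₗ[ℝ] V} (hw : w ∈ B.weylGroup) (J : Set ι) :
    B.IsFacetOfType J (facetCone (-B.simple w) J) := by
  refine Or.inr ⟨w, hw, ?_⟩
  ext v
  rw [B.image_stdFacet, Set.image_neg_eq_neg, Set.mem_neg, neg_mem_facetCone]

theorem refl_mem (i : ι) : B.refl i ∈ B.weylGroup := Subgroup.subset_closure ⟨i, rfl⟩

theorem refl_apply (i : ι) (v : V) : B.refl i v = v - B.root i v • B.coroot i :=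
  Module.reflection_apply _ _

theorem refl_mul_refl (i : ι) : B.refl i * B.refl i = 1 :=
  LinearEquiv.ext (Module.involutive_reflection (B.root_coroot i))

theorem refl_inv (i : ι) : (B.refl i)⁻¹ = B.refl i := inv_eq_of_mul_eq_one_left (B.refl_mul_refl i)

theorem root_refl (i : ι) (v : V) : B.root i (B.refl i v) = -B.root i v := by
  rw [refl_apply, map_sub, map_smul, B.root_coroot, smul_eq_mul]
  ring

theorem dualAct_refl_root (i : ι) : dualAct (B.refl i) (B.root i) = -B.root i := by
  ext v
  rw [dualAct_apply, refl_inv, root_refl, LinearMap.neg_apply]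

theorem finite_parabolic_empty : Finite (B.parabolic ∅) := by
  rw [parabolic, Set.image_empty, Subgroup.closure_empty]
  infer_instance

theorem finite_parabolic_singleton (i : ι) : Finite (B.parabolic {i}) := by
  rw [parabolic, Set.image_singleton, ← Subgroup.zpowers_eq_closure]
  exact finite_zpowers.2 (isOfFinOrder_iff_pow_eq_one.2
    ⟨2, two_pos, (pow_two _).trans (B.refl_mul_refl i)⟩)

theorem simple_rootRefl (w : V ≃ₗ[ℝ] V) (i : ι) (v : V) :
    B.simple w i (B.rootRefl w i v) = -B.simple w i v := by
  simp only [simple, dualAct_apply, rootRefl, ← LinearEquiv.mul_apply, mul_assoc,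
    inv_mul_cancel_left]
  rw [LinearEquiv.mul_apply, root_refl]

theorem rootRefl_apply_of_simple_eq_zero {w : V ≃ₗ[ℝ] V} {i : ι} {v : V}
    (hv : B.simple w i v = 0) : B.rootRefl w i v = v := by
  simp only [simple, dualAct_apply] at hv
  simp only [rootRefl, LinearEquiv.mul_apply, refl_apply, hv, zero_smul, sub_zero]
  simp

theorem simple_mul_refl_rootRefl (w : V ≃ₗ[ℝ] V) (i j : ι) (v : V) :
    B.simple (w * B.refl i) j (B.rootRefl w i v) = B.simple w j v := by
  simp only [simple, dualAct_apply, rootRefl, ← LinearEquiv.mul_apply, mul_assoc, mul_inv_rev,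
    inv_mul_cancel_left]

theorem simple_mul_refl_self (w : V ≃ₗ[ℝ] V) (i : ι) :
    B.simple (w * B.refl i) i = -B.simple w i := by
  rw [simple, dualAct_mul, dualAct_refl_root, dualAct_neg, simple]

theorem simple_mul_refl_of_eq_zero {w : V ≃ₗ[ℝ] V} {i : ι} {v : V} (hv : B.simple w i v = 0)
    (j : ι) : B.simple (w * B.refl i) j v = B.simple w j v := by
  conv_lhs => rw [← B.rootRefl_apply_of_simple_eq_zero hv]
  exact B.simple_mul_refl_rootRefl w i j v

theorem panel_mul_refl (w : V ≃ₗ[ℝ] V) (i : ι) : B.panel (w * B.refl i) i = B.panel w i := by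
  ext v
  by_cases hv : B.simple w i v = 0
  · simp only [facetCone, Set.mem_ofPred_eq, B.simple_mul_refl_of_eq_zero hv]
  · simp [facetCone, B.simple_mul_refl_self, hv]

theorem simple_mem_realRoots {w : V ≃ₗ[ℝ] V} (hw : w ∈ B.weylGroup) (j : ι) :
    B.simple w j ∈ B.realRoots := ⟨w, hw, j, rfl⟩

theorem root_mem_realRoots (i : ι) : B.root i ∈ B.realRoots := ⟨1, one_mem _, i, rfl⟩

theorem dualAct_mem_realRoots {w : V ≃ₗ[ℝ] V} (hw : w ∈ B.weylGroup) {f : Module.Dual ℝ V}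
    (hf : f ∈ B.realRoots) : dualAct w f ∈ B.realRoots := by
  obtain ⟨w', hw', i, rfl⟩ := hf
  exact ⟨w * w', mul_mem hw hw', i, rfl⟩

theorem neg_mem_realRoots {f : Module.Dual ℝ V} (hf : f ∈ B.realRoots) : -f ∈ B.realRoots := by
  obtain ⟨w, hw, i, rfl⟩ := hf
  exact ⟨w * B.refl i, mul_mem hw (B.refl_mem i), i, (B.simple_mul_refl_self w i).symm⟩

end RootBase

namespace WeylDatum

variable [Fintype ι] (D : WeylDatum V ι)

theorem allRoots_sign {w : V ≃ₗ[ℝ] V} (hw : w ∈ D.weylGroup) {β : Module.Dual ℝ V}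
    (hβ : β ∈ D.allRoots) : ∃ c : ι → ℝ, (∀ j, 0 ≤ c j) ∧
      (β = ∑ j, c j • D.simple w j ∨ -β = ∑ j, c j • D.simple w j) := by
  have hsign : dualAct w⁻¹ β ∈ D.posCone ∨ dualAct w⁻¹ (-β) ∈ D.posCone := by
    rcases hβ with hβ | hβ
    · exact D.pos_or_neg _ (D.dualAct_mem_realRoots (inv_mem hw) hβ)
    · exact D.im_pos_or_neg _ (D.im_weyl _ (inv_mem hw) _ hβ)
  have hcone : ∀ f, dualAct w⁻¹ f ∈ D.posCone →
      ∃ c : ι → ℝ, (∀ j, 0 ≤ c j) ∧ f = ∑ j, c j • D.simple w j := by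
    rintro f ⟨c, hc, h⟩
    refine ⟨c, hc, ?_⟩
    rw [← dualAct_dualAct_inv w f, h, dualAct_sum_smul]
    rfl
  rcases hsign with h | h
  · obtain ⟨c, hc, h⟩ := hcone _ h
    exact ⟨c, hc, Or.inl h⟩
  · obtain ⟨c, hc, h⟩ := hcone _ h
    exact ⟨c, hc, Or.inr h⟩

section PanelFixator

variable {D} {i : ι} {v : V} (hv : v ∈ facetCone D.root {i})
include hv

theorem posCone_apply_nonneg {β : Module.Dual ℝ V} (hβ : β ∈ D.posCone) : 0 ≤ β v := by
  obtain ⟨c, hc, rfl⟩ := hβ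
  rw [LinearMap.sum_apply]
  exact Finset.sum_nonneg fun j _ => mul_nonneg (hc j) (facetCone_nonneg hv j)

theorem eq_root_of_apply_eq_zero {β : Module.Dual ℝ V} (hβ : β ∈ D.posRoots) (h : β v = 0) :
    β = D.root i := by
  obtain ⟨hβ, c, hc, hβc⟩ := hβ
  have hmul : β = c i • D.root i := hβc.trans (eq_smul_of_sum_apply_eq_zero hc hv (hβc ▸ h))
  rw [hmul]
  exact D.reduced _ (D.root_mem_realRoots i) _ (hc i) (hmul ▸ hβ)

theorem mem_posRoots_iff {β : Module.Dual ℝ V} :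
    β ∈ D.posRoots ↔ β ∈ D.realRoots ∧ (0 < β v ∨ β = D.root i) := by
  classical
  refine ⟨fun hβ => ⟨hβ.1, ?_⟩, ?_⟩
  · exact (posCone_apply_nonneg hv hβ.2).lt_or_eq.imp_right
      fun h => eq_root_of_apply_eq_zero hv hβ h.symm
  · rintro ⟨hβ, h | rfl⟩
    · refine ⟨hβ, (D.pos_or_neg β hβ).resolve_right fun hneg => ?_⟩
      have := posCone_apply_nonneg hv hneg
      rw [LinearMap.neg_apply] at this
      linarith
    · exact ⟨hβ, Pi.single i 1, fun j => by rw [Pi.single_apply]; positivity,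
        by simp [Pi.single_apply]⟩

theorem eq_one_of_fixes_root {g : V ≃ₗ[ℝ] V} (hg : g ∈ D.weylGroup) (hgv : g v = v)
    (hgi : dualAct g (D.root i) = D.root i) : g = 1 := by
  have hmaps : ∀ g ∈ D.weylGroup, g⁻¹ v = v → dualAct g (D.root i) = D.root i →
      ∀ β ∈ D.posRoots, dualAct g β ∈ D.posRoots := fun g hg hgv hgi β hβ => by
    rw [mem_posRoots_iff hv] at hβ ⊢
    refine ⟨D.dualAct_mem_realRoots hg hβ.1, hβ.2.imp (fun h => ?_) fun h => by rw [h, hgi]⟩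
    rwa [dualAct_apply, hgv]
  have hgv' : g⁻¹ v = v := (LinearEquiv.symm_apply_eq g).2 hgv.symm
  refine D.stabilizer_pos g hg (Set.Subset.antisymm ?_ fun β hβ => ?_)
  · exact Set.image_subset_iff.2 (hmaps g hg hgv' hgi)
  · exact ⟨dualAct g⁻¹ β, hmaps g⁻¹ (inv_mem hg) (by rwa [inv_inv])
      (by rw [← hgi, dualAct_inv_dualAct, hgi]) β hβ, dualAct_dualAct_inv g β⟩

theorem eq_one_or_eq_refl {g : V ≃ₗ[ℝ] V} (hg : g ∈ D.weylGroup) (hgv : g v = v) :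
    g = 1 ∨ g = D.refl i := by
  have hgi := D.dualAct_mem_realRoots hg (D.root_mem_realRoots i)
  have hgi0 : dualAct g (D.root i) v = 0 := by
    rw [dualAct_apply, show g⁻¹ v = v from (LinearEquiv.symm_apply_eq g).2 hgv.symm]
    exact hv.1 i rfl
  rcases D.pos_or_neg _ hgi with h | h
  · exact Or.inl (eq_one_of_fixes_root hv hg hgv (eq_root_of_apply_eq_zero hv ⟨hgi, h⟩ hgi0))
  · have hneg : -dualAct g (D.root i) = D.root i :=
      eq_root_of_apply_eq_zero hv ⟨D.neg_mem_realRoots hgi, h⟩ (by simp [hgi0])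
    have hmul : g * D.refl i = 1 := by
      refine eq_one_of_fixes_root hv (mul_mem hg (D.refl_mem i)) ?_ ?_
      · rw [LinearEquiv.mul_apply, D.refl_apply, hv.1 i rfl, zero_smul, sub_zero, hgv]
      · rw [dualAct_mul, D.dualAct_refl_root, dualAct_neg, hneg]
    exact Or.inr ((mul_eq_one_iff_eq_inv.1 hmul).trans (D.refl_inv i))

end PanelFixator

/-- `g` permutes the real roots that vanish at `v`, and these are `± w αᵢ`. -/
theorem eq_one_or_eq_rootRefl {w g : V ≃ₗ[ℝ] V} (hw : w ∈ D.weylGroup) (hg : g ∈ D.weylGroup)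
    {i : ι} {v : V} (hv : v ∈ D.panel w i) (hgv : g v = v) : g = 1 ∨ g = D.rootRefl w i := by
  have hfix : (w⁻¹ * g * w) (w⁻¹ v) = w⁻¹ v := by
    simp [LinearEquiv.mul_apply, hgv]
  have hconj : g = w * (w⁻¹ * g * w) * w⁻¹ := by group
  rcases eq_one_or_eq_refl (D := D) (v := w⁻¹ v) (i := i) hv
    (mul_mem (mul_mem (inv_mem hw) hg) hw) hfix with h | h
  · exact Or.inl (by rw [hconj, h, mul_one, mul_inv_cancel])
  · exact Or.inr (by rw [hconj, h, RootBase.rootRefl])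

end WeylDatum

end Vectorial

section Real

theorem nonneg_of_forall_pos_add_mul_nonneg {a b : ℝ} (h : ∀ t > 0, 0 ≤ a + t * b) : 0 ≤ b := by
  by_contra! hb
  have := h ((|a| + 1) / -b) (div_pos (by positivity) (neg_pos.2 hb))
  rw [div_neg, neg_mul, div_mul_cancel₀ _ hb.ne] at this
  linarith [le_abs_self a]

theorem exists_forall_nonneg_add_mul {ι : Type*} [Finite ι] (a b : ι → ℝ) (hb : ∀ j, 0 < b j) :
    ∃ N > 0, ∀ j, 0 ≤ a j + N * b j := by
  have hev : ∀ᶠ N in atTop, ∀ j, 0 ≤ a j + N * b j := eventually_all.2 fun j =>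
    (tendsto_atTop_add_const_left _ (a j) (tendsto_id.atTop_mul_const (hb j))).eventually_ge_atTop 0
  obtain ⟨N, hN, h⟩ := ((eventually_gt_atTop 0).and hev).exists
  exact ⟨N, hN, h⟩

theorem not_bddAbove_and_not_bddBelow_of_point_reflection {L : Set ℝ} (hL : L.Nontrivial)
    (hrefl : ∀ s ∈ L, ∀ t ∈ L, 2 * s - t ∈ L) : ¬BddAbove L ∧ ¬BddBelow L := by
  have habove : ¬BddAbove L := fun hbdd => by
    obtain ⟨a, ha, b, hb, hab⟩ := hL.exists_lt
    have htranslate : ∀ t ∈ L, t ≤ sSup L - 2 * (b - a) := fun t ht => by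
      linarith [le_csSup hbdd (hrefl b hb _ (hrefl a ha t ht))]
    linarith [csSup_le hL.nonempty htranslate]
  refine ⟨habove, fun ⟨l, hl⟩ => habove ?_⟩
  obtain ⟨s, hs⟩ := hL.nonempty
  exact ⟨2 * s - l, fun t ht => by linarith [hl (hrefl s hs t ht)]⟩

theorem eq_univ_of_isUpperSet_of_forall_exists_lt {E : Set ℝ} (hE : IsUpperSet E)
    (hne : E.Nonempty) (hclosed : ∀ t, Set.Ioi t ⊆ E → t ∈ E) (hopen : ∀ t ∈ E, ∃ s < t, s ∈ E) :
    E = Set.univ := by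
  by_contra! hE'
  obtain ⟨l, hl⟩ := (Set.ne_univ_iff_exists_notMem E).1 hE'
  have hbdd : BddBelow E := ⟨l, fun t ht => le_of_not_gt fun htl => hl (hE htl.le ht)⟩
  have hinf : sInf E ∈ E := hclosed _ fun t ht => by
    obtain ⟨s, hs, hst⟩ := exists_lt_of_csInf_lt hne ht
    exact hE hst.le hs
  obtain ⟨s, hs, hsE⟩ := hopen _ hinf
  exact hs.not_ge (csInf_le hbdd hsE)

end Real

section FacetCone

variable {V : Type*} [AddCommGroup V] [Module ℝ V] {ι : Type*} [Finite ι]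
  {γ : ι → Module.Dual ℝ V} {J : Set ι}

theorem exists_mem_facetCone_add_nonneg (hne : (facetCone γ J).Nonempty) {u : V}
    (hu : ∀ j ∈ J, 0 ≤ γ j u) : ∃ v ∈ facetCone γ J, ∀ j, 0 ≤ γ j (u + v) := by
  obtain ⟨c, hc⟩ := hne
  obtain ⟨N, hN, h⟩ := exists_forall_nonneg_add_mul (fun j : {j // j ∉ J} => γ j u)
    (fun j => γ j c) fun j => hc.2 j j.2
  refine ⟨N • c, smul_mem_facetCone hc hN, fun j => ?_⟩
  rw [map_add, map_smul, smul_eq_mul]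
  by_cases hj : j ∈ J
  · simpa [hc.1 j hj] using hu j hj
  · exact h ⟨j, hj⟩

end FacetCone

section ConeTopology

variable {V : Type*} [NormedAddCommGroup V] [NormedSpace ℝ V] {ι : Type*}
  {γ : ι → Module.Dual ℝ V} {J : Set ι}

theorem tendsto_smul_nhdsWithin_facetCone {v : V} (hv : v ∈ facetCone γ J) :
    Tendsto (fun t : ℝ => t • v) (𝓝[>] 0) (𝓝[facetCone γ J] 0) := by
  refine tendsto_nhdsWithin_iff.2
    ⟨?_, eventually_mem_nhdsWithin.mono fun t ht => smul_mem_facetCone hv ht⟩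
  have : Tendsto (fun t : ℝ => t • v) (𝓝 0) (𝓝 ((0 : ℝ) • v)) := Continuous.tendsto (by fun_prop) 0
  rw [zero_smul] at this
  exact this.mono_left nhdsWithin_le_nhds

theorem zero_mem_closure_facetCone (h : (facetCone γ J).Nonempty) :
    (0 : V) ∈ closure (facetCone γ J) := by
  obtain ⟨v, hv⟩ := h
  exact mem_closure_iff_nhdsWithin_neBot.2 (tendsto_smul_nhdsWithin_facetCone hv).neBot

variable [FiniteDimensional ℝ V]

theorem continuous_dual (f : Module.Dual ℝ V) : Continuous f :=
  LinearMap.continuous_of_finiteDimensional f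

theorem closure_facetCone_subset :
    closure (facetCone γ J) ⊆ {v | (∀ j ∈ J, γ j v = 0) ∧ ∀ j, 0 ≤ γ j v} := by
  refine closure_minimal (fun v hv => ⟨hv.1, facetCone_nonneg hv⟩) ?_
  simp only [Set.ofPred_and, Set.ofPred_forall]
  exact (isClosed_iInter fun j => isClosed_iInter fun _ =>
      isClosed_eq (continuous_dual _) continuous_const).inter
    (isClosed_iInter fun j => isClosed_le continuous_const (continuous_dual _))

theorem add_mem_facetCone_of_mem_closure {v ξ : V} (hv : v ∈ facetCone γ J)
    (hξ : ξ ∈ closure (facetCone γ J)) : v + ξ ∈ facetCone γ J :=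
  add_mem_facetCone hv (closure_facetCone_subset hξ).1 (closure_facetCone_subset hξ).2

theorem add_mem_closure_facetCone {ξ η : V} (hξ : ξ ∈ closure (facetCone γ J))
    (hη : η ∈ closure (facetCone γ J)) : ξ + η ∈ closure (facetCone γ J) :=
  map_mem_closure (f := (· + η)) (continuous_add_const η) hξ
    fun _ hv => add_mem_facetCone_of_mem_closure hv hη

theorem isOpen_facetCone_empty [Finite ι] (γ : ι → Module.Dual ℝ V) : IsOpen (facetCone γ ∅) := by
  simp only [facetCone, Set.ofPred_and, Set.ofPred_forall]
  simpa using isOpen_iInter_of_finite fun j => isOpen_lt continuous_const (continuous_dual (γ j))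

end ConeTopology

/-! ### The model apartment -/

namespace ModelApartment

section Support

variable {V : Type*} [NormedAddCommGroup V] [NormedSpace ℝ V] {P : Type*} [AddTorsor V P]

theorem support_mono {F G : Filter P} (h : F ≤ G) : support F ≤ support G :=
  sInf_le_sInf fun _ hE => h hE

theorem eq_one_of_eventually_apply_eq {G : Filter P} (hG : support G = ⊤) {u : P ≃ᵃ[ℝ] P}
    (hu : ∀ᶠ p in G, u p = p) : u = 1 := by
  have hspan : affineSpan ℝ {p | u p = p} = ⊤ :=
    top_unique (hG ▸ sInf_le (mem_of_superset hu (subset_affineSpan ℝ _)))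
  have heq : (u : P →ᵃ[ℝ] P) = AffineMap.id ℝ P := AffineMap.ext_on hspan fun p hp => hp
  exact AffineEquiv.ext fun p => DFunLike.congr_fun heq p

theorem support_eq_top {G : Filter P}
    (h : ∀ S ∈ G, ∃ (x : P) (O : Set V), IsOpen O ∧ O.Nonempty ∧ ∀ v ∈ O, v +ᵥ x ∈ S) :
    support G = ⊤ := by
  refine sInf_eq_top.2 fun E hE => ?_
  obtain ⟨x, O, hO, hne, hOE⟩ := h _ hE
  have hcomap : E.comap (AffineEquiv.vaddConst ℝ x : V →ᵃ[ℝ] P) = ⊤ :=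
    top_unique ((hO.affineSpan_eq_top hne).ge.trans (affineSpan_le.2 hOE))
  refine top_unique fun p _ => ?_
  have hp : p -ᵥ x ∈ E.comap (AffineEquiv.vaddConst ℝ x : V →ᵃ[ℝ] P) := hcomap ▸ trivial
  simpa using hp

end Support

variable {V : Type*} [NormedAddCommGroup V] [NormedSpace ℝ V]
  {P : Type*} [AddTorsor V P] {ι : Type*} [Fintype ι] (𝔸 : ModelApartment V P ι)

section Walls

theorem linear_mem_weylGroup {u : P ≃ᵃ[ℝ] P} (hu : u ∈ 𝔸.weyl) : u.linear ∈ 𝔸.weylGroup := by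
  have hle : 𝔸.weyl ≤ 𝔸.weylGroup.comap (AffineEquiv.linearHom : (P ≃ᵃ[ℝ] P) →* _) := by
    refine (Subgroup.closure_le _).2 ?_
    rintro g ⟨M, -, -, w, hw, i, -, hg⟩
    change g.linear ∈ 𝔸.weylGroup
    rw [hg]
    exact mul_mem (mul_mem hw (𝔸.refl_mem i)) (inv_mem hw)
  exact hle hu

theorem eq_hyperplane_of_mem {f : Module.Dual ℝ V} {M : AffineSubspace ℝ P} {m : P}
    (hm : m ∈ M) (hM : M.direction = LinearMap.ker f) : M = hyperplane f m := by
  rw [hyperplane, ← hM, AffineSubspace.mk'_eq hm]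

/-- The reflection along the hyperplane of direction `Ker (w αᵢ)` through `m`. It belongs to `W`
when this hyperplane is a wall, but `m` is arbitrary. -/
def wallRefl (w : V ≃ₗ[ℝ] V) (i : ι) (m : P) : P ≃ᵃ[ℝ] P :=
  AffineEquiv.mk' (fun p => 𝔸.rootRefl w i (p -ᵥ m) +ᵥ m) (𝔸.rootRefl w i) m
    fun p => by simp

variable {w : V ≃ₗ[ℝ] V} {i : ι}

theorem wallRefl_apply (w : V ≃ₗ[ℝ] V) (i : ι) (m p : P) :
    𝔸.wallRefl w i m p = 𝔸.rootRefl w i (p -ᵥ m) +ᵥ m := rfl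

theorem wallRefl_vadd_of_simple_eq_zero {v : V} (hv : 𝔸.simple w i v = 0) (m : P) :
    𝔸.wallRefl w i (v +ᵥ m) = 𝔸.wallRefl w i m := by
  ext p
  simp only [wallRefl_apply, vsub_vadd_eq_vsub_sub, map_sub,
    𝔸.rootRefl_apply_of_simple_eq_zero hv, vadd_vadd, sub_add_cancel]

theorem wallRefl_mem (hw : w ∈ 𝔸.weylGroup) {m : P}
    (hm : hyperplane (𝔸.simple w i) m ∈ 𝔸.walls) : 𝔸.wallRefl w i m ∈ 𝔸.weyl := by
  refine Subgroup.subset_closure ⟨_, hm, fun p hp => ?_, w, hw, i,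
    AffineSubspace.direction_mk' _ _, rfl⟩
  rw [hyperplane, AffineSubspace.mem_mk', LinearMap.mem_ker] at hp
  rw [wallRefl_apply, 𝔸.rootRefl_apply_of_simple_eq_zero hp, vsub_vadd]

theorem eq_one_or_eq_wallRefl (hw : w ∈ 𝔸.weylGroup) {u : P ≃ᵃ[ℝ] P} (hu : u ∈ 𝔸.weyl)
    {m : P} (hum : u m = m) {v : V} (hv : v ∈ 𝔸.panel w i) (huv : u.linear v = v) :
    u = 1 ∨ u = 𝔸.wallRefl w i m := by
  have happly : ∀ p, u p = u.linear (p -ᵥ m) +ᵥ m := fun p => by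
    rw [← hum, ← u.map_vadd, hum, vsub_vadd]
  refine (𝔸.eq_one_or_eq_rootRefl hw (𝔸.linear_mem_weylGroup hu) hv huv).imp
    (fun h => ?_) fun h => ?_ <;> ext p <;> rw [happly p, h]
  · exact vsub_vadd p m
  · rfl

theorem hyperplane_wallRefl_mem (hw : w ∈ 𝔸.weylGroup) {m n : P}
    (hm : hyperplane (𝔸.simple w i) m ∈ 𝔸.walls) (hn : hyperplane (𝔸.simple w i) n ∈ 𝔸.walls) :
    hyperplane (𝔸.simple w i) (𝔸.wallRefl w i m n) ∈ 𝔸.walls := by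
  have hker : (LinearMap.ker (𝔸.simple w i)).map (𝔸.rootRefl w i : V →ₗ[ℝ] V) =
      LinearMap.ker (𝔸.simple w i) := by
    ext v
    constructor
    · rintro ⟨u, hu, rfl⟩
      rw [LinearMap.mem_ker, LinearEquiv.coe_coe, 𝔸.simple_rootRefl, LinearMap.mem_ker.1 hu,
        neg_zero]
    · exact fun hv => ⟨v, hv, 𝔸.rootRefl_apply_of_simple_eq_zero hv⟩
  have hmap := 𝔸.walls_stable _ (𝔸.wallRefl_mem hw hm) _ hn
  rw [hyperplane, AffineSubspace.map_mk'] at hmap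
  rw [hyperplane, ← hker]
  exact hmap

/-- The values of `f (· - y)` on the walls of direction `Ker f`. Reflections in walls show that they
are unbounded above and below, so that there are walls on both sides of `y`. -/
def wallLevels (f : Module.Dual ℝ V) (y : P) : Set ℝ :=
  (fun q => f (q -ᵥ y)) '' {q | hyperplane f q ∈ 𝔸.walls}

theorem wallLevels_nontrivial {f : Module.Dual ℝ V} (hf : f ∈ 𝔸.realRoots) (y : P) :
    (𝔸.wallLevels f y).Nontrivial := by
  have hform : ∀ M ∈ {M | M ∈ 𝔸.walls ∧ M.direction = LinearMap.ker f},
      ∃ m, M = hyperplane f m := by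
    rintro M ⟨hM, hdir⟩
    obtain ⟨g, -, m, rfl⟩ := 𝔸.wall_direction M hM
    exact ⟨m, eq_hyperplane_of_mem (AffineSubspace.self_mem_mk' m _) hdir⟩
  obtain ⟨M, hM, M', hM', hne⟩ := (𝔸.infinite_walls f hf).nontrivial
  obtain ⟨m, rfl⟩ := hform M hM
  obtain ⟨m', rfl⟩ := hform M' hM'
  refine ⟨_, ⟨m, hM.1, rfl⟩, _, ⟨m', hM'.1, rfl⟩, fun heq => hne ?_⟩
  refine eq_hyperplane_of_mem ?_ (AffineSubspace.direction_mk' _ _)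
  rw [hyperplane, AffineSubspace.mem_mk', LinearMap.mem_ker, ← vsub_sub_vsub_cancel_right m' m y,
    map_sub]
  exact sub_eq_zero.2 heq.symm

theorem two_mul_sub_mem_wallLevels (hw : w ∈ 𝔸.weylGroup) {y : P} {s t : ℝ}
    (hs : s ∈ 𝔸.wallLevels (𝔸.simple w i) y) (ht : t ∈ 𝔸.wallLevels (𝔸.simple w i) y) :
    2 * s - t ∈ 𝔸.wallLevels (𝔸.simple w i) y := by
  obtain ⟨m, hm, rfl⟩ := hs
  obtain ⟨n, hn, rfl⟩ := ht
  refine ⟨_, 𝔸.hyperplane_wallRefl_mem hw hm hn, ?_⟩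
  simp only [wallRefl_apply, vadd_vsub_assoc, map_add, 𝔸.simple_rootRefl]
  rw [← vsub_sub_vsub_cancel_right n m y, map_sub]
  ring

theorem exists_wall_gt (hw : w ∈ 𝔸.weylGroup) (i : ι) (y : P) :
    ∃ m, hyperplane (𝔸.simple w i) m ∈ 𝔸.walls ∧ 0 < 𝔸.simple w i (m -ᵥ y) := by
  obtain ⟨_, ⟨m, hm, rfl⟩, hpos⟩ := not_bddAbove_iff.1
    (not_bddAbove_and_not_bddBelow_of_point_reflection
      (𝔸.wallLevels_nontrivial (𝔸.simple_mem_realRoots hw i) y)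
      fun _ hs _ ht => 𝔸.two_mul_sub_mem_wallLevels hw hs ht).1 0
  exact ⟨m, hm, hpos⟩

theorem exists_wall_lt (hw : w ∈ 𝔸.weylGroup) (i : ι) (y : P) :
    ∃ m, hyperplane (𝔸.simple w i) m ∈ 𝔸.walls ∧ 𝔸.simple w i (m -ᵥ y) < 0 := by
  obtain ⟨_, ⟨m, hm, rfl⟩, hneg⟩ := not_bddBelow_iff.1
    (not_bddAbove_and_not_bddBelow_of_point_reflection
      (𝔸.wallLevels_nontrivial (𝔸.simple_mem_realRoots hw i) y)
      fun _ hs _ ht => 𝔸.two_mul_sub_mem_wallLevels hw hs ht).2 0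
  exact ⟨m, hm, hneg⟩

end Walls

variable {𝔸}

section Enclosure

theorem IsInter.isInter_anyHalves {T : Set P} (hT : 𝔸.IsInter 𝔸.closedHalves T) :
    𝔸.IsInter 𝔸.anyHalves T := by
  obtain ⟨k, hk, rfl⟩ := hT
  exact ⟨k, fun f hf => 𝔸.closedHalves_subset f (hk f hf), rfl⟩

theorem IsInter.mem_of_forall_allRoots {T : Set P} (hT : 𝔸.IsInter 𝔸.closedHalves T) {p : P}
    (h : ∀ β ∈ 𝔸.allRoots, ∀ n : P, (∀ q ∈ T, 0 ≤ β (q -ᵥ n)) → 0 ≤ β (p -ᵥ n)) : p ∈ T := by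
  obtain ⟨k, hk, rfl⟩ := hT
  refine Set.mem_iInter₂.2 fun β hβ => ?_
  rcases hk β hβ with hkβ | ⟨n, -, hkβ⟩
  · exact hkβ ▸ trivial
  · rw [hkβ]
    exact h β hβ n fun q hq => (hkβ ▸ Set.mem_iInter₂.1 hq β hβ : q ∈ closedHalf β n)

theorem IsInter.vadd_mem_of_ray {T : Set P} (hT : 𝔸.IsInter 𝔸.closedHalves T) {v : V} {y p : P}
    (hray : ∀ t > (0 : ℝ), t • v +ᵥ y ∈ T) (hp : p ∈ T) : v +ᵥ p ∈ T := by
  refine hT.mem_of_forall_allRoots fun β _ n h => ?_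
  have hv : 0 ≤ β v := nonneg_of_forall_pos_add_mul_nonneg (a := β (y -ᵥ n)) fun t ht => by
    have := h _ (hray t ht)
    rwa [vadd_vsub_assoc, map_add, map_smul, smul_eq_mul, add_comm] at this
  rw [vadd_vsub_assoc, map_add]
  exact add_nonneg hv (h p hp)

theorem IsInter.mem_of_segment {T : Set P} (hT : 𝔸.IsInter 𝔸.closedHalves T) {c : V} {q : P}
    (h : ∀ᶠ t in 𝓝[>] (0 : ℝ), t • c +ᵥ q ∈ T) : q ∈ T := by
  refine hT.mem_of_forall_allRoots fun β _ n hβ => ?_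
  have hlim : Tendsto (fun t : ℝ => t * β c + β (q -ᵥ n)) (𝓝 0) (𝓝 (0 * β c + β (q -ᵥ n))) :=
    Continuous.tendsto (by fun_prop) 0
  rw [zero_mul, zero_add] at hlim
  refine ge_of_tendsto (hlim.mono_left nhdsWithin_le_nhds) (h.mono fun t ht => ?_)
  have := hβ _ ht
  rwa [vadd_vsub_assoc, map_add, map_smul, smul_eq_mul] at this

theorem isInter_iInter_closedHalf {κ : Type*} {f : κ → Module.Dual ℝ V}
    (hf : Function.Injective f) {m : κ → P} (hm : ∀ j, 𝔸.IsWallAt (f j) (m j)) :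
    𝔸.IsInter 𝔸.closedHalves (⋂ j, closedHalf (f j) (m j)) := by
  refine ⟨Function.extend f (fun j => closedHalf (f j) (m j)) fun _ => Set.univ,
    fun β _ => ?_, Set.Subset.antisymm ?_ ?_⟩
  · by_cases hβ : ∃ j, f j = β
    · obtain ⟨j, rfl⟩ := hβ
      exact Or.inr ⟨m j, hm j, hf.extend_apply _ _ j⟩
    · exact Or.inl (Function.extend_apply' _ _ _ hβ)
  · refine Set.subset_iInter₂ fun β _ => ?_
    by_cases hβ : ∃ j, f j = β
    · obtain ⟨j, rfl⟩ := hβ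
      rw [hf.extend_apply]
      exact Set.iInter_subset _ j
    · rw [Function.extend_apply' _ _ _ hβ]
      exact Set.subset_univ _
  · refine Set.subset_iInter fun j => ?_
    have hj : f j ∈ 𝔸.allRoots := (hm j).imp_left And.left
    refine (Set.iInter₂_subset (f j) hj).trans ?_
    rw [hf.extend_apply]

theorem isInter_simple {w : V ≃ₗ[ℝ] V} (hw : w ∈ 𝔸.weylGroup) {m : ι → P}
    (hm : ∀ j, hyperplane (𝔸.simple w j) (m j) ∈ 𝔸.walls) :
    𝔸.IsInter 𝔸.closedHalves (⋂ j, closedHalf (𝔸.simple w j) (m j)) :=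
  isInter_iInter_closedHalf (𝔸.simple_linearIndependent w).injective
    fun j => Or.inl ⟨𝔸.simple_mem_realRoots hw j, hm j⟩

theorem le_enclosure (F : Filter P) : F ≤ 𝔸.enclosure F := by
  rintro S ⟨T, hT, -, hTS⟩
  exact mem_of_superset hT hTS

theorem localFacet_le_facet (x : P) (Fv : Set V) : localFacet x Fv ≤ 𝔸.facet x Fv := by
  rintro S ⟨T, hT, -, hTS⟩
  exact mem_of_superset hT hTS

omit [NormedSpace ℝ V] in
theorem mem_addSet {F : Filter P} {E : Set V} {S : Set P} :
    S ∈ addSet F E ↔ ∃ U ∈ F, ∀ v ∈ E, ∀ p ∈ U, v +ᵥ p ∈ S := by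
  rw [addSet, mem_map, mem_prod_iff]
  constructor
  · rintro ⟨t, ht, U, hU, h⟩
    exact ⟨U, hU, fun v hv p hp => h (Set.mk_mem_prod (ht hv) hp)⟩
  · rintro ⟨U, hU, h⟩
    exact ⟨E, mem_principal_self E, U, hU, fun q hq => h _ hq.1 _ hq.2⟩

theorem mem_enclosure_addSet_map_vadd {F : Filter P} {E : Set V} {ξ : V} {S : Set P} :
    S ∈ 𝔸.enclosure (addSet (map (fun p => ξ +ᵥ p) F) E) ↔ ∃ T, 𝔸.IsInter 𝔸.closedHalves T ∧
      T ⊆ S ∧ ∃ U ∈ F, ∀ v ∈ E, ∀ p ∈ U, v +ᵥ (ξ +ᵥ p) ∈ T := by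
  constructor
  · rintro ⟨T, hT, hi, hTS⟩
    obtain ⟨U, hU, h⟩ := mem_addSet.1 hT
    exact ⟨T, hi, hTS, _, hU, fun v hv p hp => h v hv _ hp⟩
  · rintro ⟨T, hi, hTS, U, hU, h⟩
    refine ⟨T, mem_addSet.2 ⟨_, image_mem_map hU, ?_⟩, hi, hTS⟩
    rintro v hv _ ⟨p, hp, rfl⟩
    exact h v hv p hp

end Enclosure

section MinimalFacet

theorem allRoots_apply_eq_zero {β : Module.Dual ℝ V} (hβ : β ∈ 𝔸.allRoots) {v : V}
    (hv : v ∈ 𝔸.stdFacet Set.univ) : β v = 0 := by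
  have hsimple : ∀ j, 𝔸.simple 1 j v = 0 := fun j => hv.1 j trivial
  obtain ⟨c, -, h | h⟩ := 𝔸.allRoots_sign (one_mem _) hβ
  · simp [h, hsimple]
  · rw [← neg_eq_zero, ← LinearMap.neg_apply, h]
    simp [hsimple]

theorem pure_le_facet_stdFacet_univ (x : P) : pure x ≤ 𝔸.facet x (𝔸.stdFacet Set.univ) := by
  refine le_trans (fun S hS => ?_) (localFacet_le_facet _ _)
  have h0 : (0 : V) ∈ 𝔸.stdFacet Set.univ := ⟨by simp, by simp⟩
  simpa using mem_of_mem_nhdsWithin h0 hS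

theorem facet_stdFacet_univ_le (x : P) :
    𝔸.facet x (𝔸.stdFacet Set.univ) ≤ 𝔸.enclosure (pure x) := by
  rintro S ⟨T, hT, hi, hTS⟩
  refine ⟨T, ?_, hi.isInter_anyHalves, hTS⟩
  change ∀ᶠ v in 𝓝[𝔸.stdFacet Set.univ] 0, v +ᵥ x ∈ T
  refine eventually_mem_nhdsWithin.mono fun v hv => hi.mem_of_forall_allRoots fun β hβ n h => ?_
  rw [vadd_vsub_assoc, map_add, allRoots_apply_eq_zero hβ hv, zero_add]
  exact h x hT

end MinimalFacet

section SectorGerm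

/-- The germ of the sectors of direction `C`. -/
def sectorGerm (C : Set V) : Filter P := ⨅ x : P, 𝓟 ((fun v => v +ᵥ x) '' C)

theorem mem_sectorGerm {κ : Type*} [Finite κ] {γ : κ → Module.Dual ℝ V}
    (hne : (facetCone γ ∅).Nonempty) {S : Set P} :
    S ∈ sectorGerm (P := P) (facetCone γ ∅) ↔ ∃ x : P, ∀ v ∈ facetCone γ ∅, v +ᵥ x ∈ S := by
  have : Nonempty P := AddTorsor.nonempty (G := V)
  rw [sectorGerm, mem_iInf_of_directed fun x y => ?_]
  · simp [Set.subset_def]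
  obtain ⟨c, hc, h⟩ := exists_mem_facetCone_add_nonneg hne (u := x -ᵥ y) (by simp)
  refine ⟨c +ᵥ x, ?_, ?_⟩ <;> refine principal_mono.2 ?_ <;> rintro _ ⟨v, hv, rfl⟩
  · exact ⟨v + c, add_mem_facetCone hv (by simp) (facetCone_nonneg hc), by simp [add_vadd]⟩
  · refine ⟨v + (x -ᵥ y + c), add_mem_facetCone hv (by simp) h, ?_⟩
    rw [add_comm _ c]
    simp [add_vadd]

variable {w : V ≃ₗ[ℝ] V}

theorem isSectorGerm_sectorGerm (hw : w ∈ 𝔸.weylGroup) :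
    𝔸.IsSectorGerm (sectorGerm (𝔸.chamber w)) :=
  ⟨_, 𝔸.isFacetOfType_facetCone hw ∅, rfl⟩

variable [FiniteDimensional ℝ V]

theorem facetCone_simple_nonempty (𝔸 : ModelApartment V P ι) (w : V ≃ₗ[ℝ] V) (J : Set ι) :
    (facetCone (𝔸.simple w) J).Nonempty :=
  facetCone_nonempty (𝔸.simple_linearIndependent w) J

theorem mem_sectorGerm_chamber {S : Set P} :
    S ∈ sectorGerm (𝔸.chamber w) ↔ ∃ x : P, ∀ v ∈ 𝔸.chamber w, v +ᵥ x ∈ S :=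
  mem_sectorGerm (𝔸.facetCone_simple_nonempty w ∅)

theorem support_sectorGerm (w : V ≃ₗ[ℝ] V) :
    support (sectorGerm (P := P) (𝔸.chamber w)) = ⊤ :=
  support_eq_top fun _ hS =>
    let ⟨x, hx⟩ := mem_sectorGerm_chamber.1 hS
    ⟨x, _, isOpen_facetCone_empty _, 𝔸.facetCone_simple_nonempty w ∅, hx⟩

theorem chimneyGerm_eq_sectorGerm (hw : w ∈ 𝔸.weylGroup) {F : Filter P} {x : P}
    (hxF : pure x ≤ F) (hFx : F ≤ 𝔸.enclosure (pure x)) :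
    𝔸.chimneyGerm F (𝔸.chamber w) = sectorGerm (𝔸.chamber w) := by
  refine le_antisymm (le_iInf fun y => le_principal_iff.2 ?_) (le_iInf₂ fun ξ _ S hS => ?_)
  · obtain ⟨c, hc⟩ := 𝔸.facetCone_simple_nonempty w ∅
    choose m hm hym using fun j => 𝔸.exists_wall_gt hw j y
    choose n hn hnx using fun j => 𝔸.exists_wall_lt hw j x
    obtain ⟨N, hN, hNmn⟩ := exists_forall_nonneg_add_mul (fun j => 𝔸.simple w j (n j -ᵥ m j))
      (fun j => 𝔸.simple w j c) fun j => hc.2 j (Set.notMem_empty j)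
    have hF : (⋂ j, closedHalf (𝔸.simple w j) (n j)) ∈ F := by
      refine hFx ⟨_, Set.mem_iInter.2 fun j => ?_, isInter_simple hw hn, subset_rfl⟩
      change 0 ≤ 𝔸.simple w j (x -ᵥ n j)
      rw [← neg_vsub_eq_vsub_rev, map_neg]
      exact (neg_pos.2 (hnx j)).le
    refine mem_iInf_of_mem _ (mem_iInf_of_mem (subset_closure (smul_mem_facetCone hc hN))
      (mem_enclosure_addSet_map_vadd.2 ⟨_, isInter_simple hw hm, fun p hp => ?_, _, hF,
        fun v hv p hp => Set.mem_iInter.2 fun j => ?_⟩))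
    · refine ⟨p -ᵥ y, ⟨by simp, fun j _ => ?_⟩, vsub_vadd _ _⟩
      rw [← vsub_add_vsub_cancel p (m j) y, map_add]
      exact add_pos_of_nonneg_of_pos (Set.mem_iInter.1 hp j) (hym j)
    · have hpn : 0 ≤ 𝔸.simple w j (p -ᵥ n j) := Set.mem_iInter.1 hp j
      change 0 ≤ 𝔸.simple w j ((v +ᵥ (N • c +ᵥ p)) -ᵥ m j)
      rw [vadd_vsub_assoc, vadd_vsub_assoc, ← vsub_add_vsub_cancel p (n j) (m j)]
      simp only [map_add, map_smul, smul_eq_mul]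
      linarith [facetCone_nonneg hv j, hNmn j]
  · obtain ⟨T, -, hTS, U, hU, h⟩ := mem_enclosure_addSet_map_vadd.1 hS
    exact mem_sectorGerm_chamber.2 ⟨ξ +ᵥ x, fun v hv => hTS (h v hv x (mem_pure.1 (hxF hU)))⟩

theorem isSplayedChimneyGerm_sectorGerm (hw : w ∈ 𝔸.weylGroup) :
    𝔸.IsSplayedChimneyGerm (sectorGerm (𝔸.chamber w)) := by
  obtain ⟨x⟩ : Nonempty P := AddTorsor.nonempty (G := V)
  exact ⟨x, _, _, ⟨Set.univ, Or.inl ⟨1, one_mem _, by simp⟩⟩,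
    ⟨∅, 𝔸.finite_parabolic_empty, 𝔸.isFacetOfType_facetCone hw ∅⟩,
    (chimneyGerm_eq_sectorGerm hw (pure_le_facet_stdFacet_univ x) (facet_stdFacet_univ_le x)).symm⟩

theorem IsInter.mem_of_mem_sectorGerm {T : Set P} (hT : 𝔸.IsInter 𝔸.closedHalves T)
    (hTG : T ∈ sectorGerm (𝔸.chamber w)) {p q : P} (hp : p ∈ T)
    (hpq : ∀ j, 0 ≤ 𝔸.simple w j (q -ᵥ p)) : q ∈ T := by
  obtain ⟨x, hx⟩ := mem_sectorGerm_chamber.1 hTG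
  obtain ⟨c, hc⟩ := 𝔸.facetCone_simple_nonempty w ∅
  have hvadd : ∀ v ∈ 𝔸.chamber w, v +ᵥ p ∈ T := fun v hv =>
    hT.vadd_mem_of_ray (fun t ht => hx _ (smul_mem_facetCone hv ht)) hp
  refine hT.mem_of_segment (c := c) (eventually_mem_nhdsWithin.mono fun t ht => ?_)
  have := hvadd _ (add_mem_facetCone (smul_mem_facetCone hc ht) (by simp) hpq)
  rwa [add_vadd, vsub_vadd] at this

end SectorGerm

section Chimney

variable {γ : ι → Module.Dual ℝ V} {J : Set ι} {w : V ≃ₗ[ℝ] V}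

theorem chimneyGerm_le_chimney (hne : (facetCone γ J).Nonempty) (F : Filter P) :
    𝔸.chimneyGerm F (facetCone γ J) ≤ 𝔸.chimney F (facetCone γ J) := by
  refine (iInf₂_le 0 (zero_mem_closure_facetCone hne)).trans ?_
  simp only [zero_vadd, map_id', chimney, le_refl]

theorem isSolid_of_support_eq_top {F : Filter P} (hF : support F = ⊤) : 𝔸.IsSolid F := by
  refine (Set.finite_singleton (1 : V ≃ₗ[ℝ] V)).subset fun g hg => LinearEquiv.ext fun v => ?_
  exact hg.2 v (by rw [hF, AffineSubspace.direction_top]; trivial)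

variable [FiniteDimensional ℝ V]

theorem exists_isInter_of_mem_chimneyGerm (hne : (facetCone γ J).Nonempty) {F : Filter P}
    {S : Set P} (hS : S ∈ 𝔸.chimneyGerm F (facetCone γ J)) :
    ∃ ξ ∈ closure (facetCone γ J), ∃ T, 𝔸.IsInter 𝔸.closedHalves T ∧ T ⊆ S ∧
      ∀ᶠ p in F, ∀ v ∈ facetCone γ J, v +ᵥ (ξ +ᵥ p) ∈ T := by
  have hanti : ∀ ξ, ∀ η ∈ closure (facetCone γ J),
      𝔸.enclosure (addSet (map (fun p => (η + ξ) +ᵥ p) F) (facetCone γ J)) ≤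
        𝔸.enclosure (addSet (map (fun p => ξ +ᵥ p) F) (facetCone γ J)) := fun ξ η hη S hS => by
    obtain ⟨T, hT, hTS, U, hU, h⟩ := mem_enclosure_addSet_map_vadd.1 hS
    refine mem_enclosure_addSet_map_vadd.2 ⟨T, hT, hTS, U, hU, fun v hv p hp => ?_⟩
    have := h _ (add_mem_facetCone_of_mem_closure hv hη) p hp
    rwa [add_vadd, vadd_vadd η] at this
  rw [chimneyGerm, mem_biInf_of_directed] at hS
  · obtain ⟨ξ, hξ, hS⟩ := hS
    obtain ⟨T, hT, hTS, U, hU, h⟩ := mem_enclosure_addSet_map_vadd.1 hS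
    exact ⟨ξ, hξ, T, hT, hTS, mem_of_superset hU fun p hp v hv => h v hv p hp⟩
  · exact fun ξ hξ η hη => ⟨η + ξ, add_mem_closure_facetCone hη hξ, hanti ξ η hη,
      add_comm ξ η ▸ hanti η ξ hξ⟩
  · exact hne.closure

theorem support_chimneyGerm (hne : (facetCone γ J).Nonempty) (x : P) :
    support (𝔸.chimneyGerm (𝔸.facet x (𝔸.chamber w)) (facetCone γ J)) = ⊤ := by
  refine support_eq_top fun S hS => ?_
  obtain ⟨ξ, -, T, -, hTS, hT⟩ := exists_isInter_of_mem_chimneyGerm hne hS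
  obtain ⟨v, hv⟩ := hne
  obtain ⟨O, hO, h0, hOT⟩ := mem_nhdsWithin.1 (localFacet_le_facet x _ hT)
  refine ⟨v +ᵥ (ξ +ᵥ x), _, hO.inter (isOpen_facetCone_empty _), mem_closure_iff.1
    (zero_mem_closure_facetCone (𝔸.facetCone_simple_nonempty w ∅)) O hO h0, fun u hu => hTS ?_⟩
  rw [vadd_comm u v, vadd_comm u ξ]
  exact hOT hu v hv

theorem isSolid_chimney (hne : (facetCone γ J).Nonempty) (x : P) :
    𝔸.IsSolid (𝔸.chimney (𝔸.facet x (𝔸.chamber w)) (facetCone γ J)) :=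
  isSolid_of_support_eq_top <| top_unique <|
    (support_chimneyGerm hne x).ge.trans (support_mono (chimneyGerm_le_chimney hne _))

theorem exists_eventually_vadd_mem_of_mem_chimneyGerm (hne : (facetCone γ J).Nonempty) {x : P}
    {S : Set P} (hS : S ∈ 𝔸.chimneyGerm (𝔸.facet x (𝔸.chamber w)) (facetCone γ J)) {c : V}
    (hc : c ∈ 𝔸.chamber w) : ∃ ξ ∈ closure (facetCone γ J), ∀ᶠ s in 𝓝[≥] (0 : ℝ),
      ∀ v ∈ facetCone γ J, v +ᵥ (s • c +ᵥ (ξ +ᵥ x)) ∈ S := by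
  obtain ⟨ξ, hξ, T, hT, hTS, hev⟩ := exists_isInter_of_mem_chimneyGerm hne hS
  have hpos : ∀ᶠ s in 𝓝[>] (0 : ℝ), ∀ v ∈ facetCone γ J, v +ᵥ (s • c +ᵥ (ξ +ᵥ x)) ∈ T := by
    refine ((tendsto_smul_nhdsWithin_facetCone hc).eventually
      (localFacet_le_facet x _ hev)).mono fun s hs v hv => ?_
    rw [vadd_comm (s • c) ξ]
    exact hs v hv
  have hzero : ∀ v ∈ facetCone γ J, v +ᵥ ((0 : ℝ) • c +ᵥ (ξ +ᵥ x)) ∈ T := fun v hv =>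
    hT.mem_of_segment (c := c) (hpos.mono fun s hs => by
      rw [zero_smul, zero_vadd, vadd_comm (s • c) v]
      exact hs v hv)
  refine ⟨ξ, hξ, ?_⟩
  rw [← Set.Ioi_insert, nhdsWithin_insert, eventually_sup, eventually_pure]
  exact ⟨fun v hv => hTS (hzero v hv), hpos.mono fun s hs v hv => hTS (hs v hv)⟩

end Chimney

theorem IsInter.mem_of_oppositePanel [FiniteDimensional ℝ V] {w : V ≃ₗ[ℝ] V} {T : Set P}
    (hT : 𝔸.IsInter 𝔸.closedHalves T) (hw : w ∈ 𝔸.weylGroup) {i : ι} {y m p : P}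
    (hy : ∀ v ∈ 𝔸.oppositePanel w i, v +ᵥ y ∈ T) (hm : m ∈ T)
    (hpm : ∀ j, 𝔸.simple w j (p -ᵥ m) ≤ 0) (hpy : 0 ≤ 𝔸.simple w i (p -ᵥ y)) : p ∈ T := by
  refine hT.mem_of_forall_allRoots fun β hβ n h => ?_
  obtain ⟨c, hc, hβc | hβc⟩ := 𝔸.allRoots_sign hw hβ
  · obtain ⟨v, hv⟩ := 𝔸.facetCone_simple_nonempty w {i}
    have hv' : -v ∈ 𝔸.oppositePanel w i := neg_mem_facetCone.2 hv
    have hβv : β v ≤ 0 := by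
      rw [← neg_nonneg, ← map_neg]
      refine nonneg_of_forall_pos_add_mul_nonneg (a := β (y -ᵥ n)) fun t ht => ?_
      have := h _ (hy _ (smul_mem_facetCone hv' ht))
      rwa [vadd_vsub_assoc, map_add, map_smul, smul_eq_mul, add_comm] at this
    have hβv' : 0 ≤ β v := by
      rw [hβc, LinearMap.sum_apply]
      exact Finset.sum_nonneg fun j _ => mul_nonneg (hc j) (facetCone_nonneg hv j)
    -- `0 ≤ β v` and `β` is bounded below along `-v`, so `β` vanishes at the point `v` of the panel.
    have hβi : β = c i • 𝔸.simple w i :=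
      hβc.trans (eq_smul_of_sum_apply_eq_zero hc hv (hβc ▸ hβv.antisymm hβv'))
    have hβp : 0 ≤ β (p -ᵥ y) := hβi ▸ mul_nonneg (hc i) hpy
    have hβy := h _ (hy _ hv')
    rw [vadd_vsub_assoc, map_add, map_neg] at hβy
    rw [← vsub_add_vsub_cancel p y n, map_add]
    linarith
  · have hβp : 0 ≤ β (p -ᵥ m) := by
      rw [← neg_nonpos, ← LinearMap.neg_apply, hβc, LinearMap.sum_apply]
      exact Finset.sum_nonpos fun j _ => mul_nonpos_of_nonneg_of_nonpos (hc j) (hpm j)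
    rw [← vsub_add_vsub_cancel p m n, map_add]
    exact add_nonneg hβp (h m hm)

section TruncatedCone

variable (𝔸) in
/-- The part of the closed cone `m - w C` where the root `w αᵢ`, counted from `m`, is at least
`t`. -/
def truncatedCone (w : V ≃ₗ[ℝ] V) (i : ι) (m : P) (t : ℝ) : Set P :=
  {p | (∀ j, 𝔸.simple w j (p -ᵥ m) ≤ 0) ∧ t ≤ 𝔸.simple w i (p -ᵥ m)}

variable {w : V ≃ₗ[ℝ] V} {i : ι} {m : P} {t : ℝ}

theorem self_mem_truncatedCone (ht : t ≤ 0) : m ∈ 𝔸.truncatedCone w i m t := by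
  simp [truncatedCone, ht]

theorem neg_vadd_mem_truncatedCone (ht : t ≤ 0) {v : V} (hv : v ∈ 𝔸.panel w i) :
    -v +ᵥ m ∈ 𝔸.truncatedCone w i m t := by
  simpa [truncatedCone, hv.1 i rfl, ht] using facetCone_nonneg hv

theorem simple_wallRefl (w : V ≃ₗ[ℝ] V) (i j : ι) (m p q : P) :
    𝔸.simple (w * 𝔸.refl i) j (𝔸.wallRefl w i m p -ᵥ 𝔸.wallRefl w i m q) =
      𝔸.simple w j (p -ᵥ q) := by
  rw [wallRefl_apply, wallRefl_apply, vadd_vsub_vadd_cancel_right, ← map_sub,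
    vsub_sub_vsub_cancel_right, 𝔸.simple_mul_refl_rootRefl]

theorem isSplayedChimneyGerm_oppositePanel (hw : w ∈ 𝔸.weylGroup) {w' : V ≃ₗ[ℝ] V}
    (hw' : w' ∈ 𝔸.weylGroup) (i : ι) (x : P) : 𝔸.IsSplayedChimneyGerm
      (𝔸.chimneyGerm (𝔸.facet x (𝔸.chamber w')) (𝔸.oppositePanel w i)) :=
  ⟨x, _, _, ⟨∅, 𝔸.isFacetOfType_facetCone hw' ∅⟩,
    ⟨{i}, 𝔸.finite_parabolic_singleton i, 𝔸.isFacetOfType_facetCone_neg hw {i}⟩, rfl⟩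

variable [FiniteDimensional ℝ V]

theorem exists_mem_truncatedCone_simple_eq (𝔸 : ModelApartment V P ι) (w : V ≃ₗ[ℝ] V) (i : ι)
    (m : P) (ht : t ≤ 0) :
    ∃ p ∈ 𝔸.truncatedCone w i m t, 𝔸.simple w i (p -ᵥ m) = t := by
  obtain ⟨c, hc⟩ := 𝔸.facetCone_simple_nonempty w ∅
  have hci : 0 < 𝔸.simple w i c := hc.2 i (Set.notMem_empty i)
  have hlevel : 𝔸.simple w i (((t / 𝔸.simple w i c) • c +ᵥ m) -ᵥ m) = t := by
    rw [vadd_vsub, map_smul, smul_eq_mul, div_mul_cancel₀ _ hci.ne']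
  refine ⟨_, ⟨fun j => ?_, hlevel.ge⟩, hlevel⟩
  rw [vadd_vsub, map_smul]
  exact mul_nonpos_of_nonpos_of_nonneg (div_nonpos_of_nonpos_of_nonneg ht hci.le)
    (facetCone_nonneg hc j)

theorem exists_oppositePanel_vadd_mem_truncatedCone {y p : P} (ht : t ≤ 0)
    (hy : 𝔸.simple w i (y -ᵥ m) = t) (hp : p ∈ 𝔸.truncatedCone w i m t) :
    ∃ v ∈ 𝔸.oppositePanel w i, v +ᵥ y ∈ 𝔸.truncatedCone w i m t ∧
      ∀ j, 0 ≤ 𝔸.simple w j (p -ᵥ (v +ᵥ y)) := by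
  have hne := 𝔸.facetCone_simple_nonempty w {i}
  obtain ⟨v, hv, hmv⟩ := exists_mem_facetCone_add_nonneg hne (u := m -ᵥ y) <| by
    rintro _ rfl
    rw [← neg_vsub_eq_vsub_rev, map_neg, hy]
    exact neg_nonneg.2 ht
  obtain ⟨v', hv', hpv⟩ := exists_mem_facetCone_add_nonneg hne (u := p -ᵥ y) <| by
    rintro _ rfl
    rw [← vsub_sub_vsub_cancel_right p y m, map_sub, hy]
    exact sub_nonneg.2 hp.2
  have hvv' : v + v' ∈ 𝔸.panel w i := add_mem_facetCone hv hv'.1 (facetCone_nonneg hv')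
  refine ⟨-(v + v'), neg_mem_facetCone.2 hvv', ⟨fun j => ?_, ?_⟩, fun j => ?_⟩
  · have := hmv j
    rw [← neg_vsub_eq_vsub_rev, map_add, map_neg] at this
    rw [vadd_vsub_assoc, map_add, map_neg, map_add]
    linarith [facetCone_nonneg hv' j]
  · rw [vadd_vsub_assoc, map_add, map_neg, hvv'.1 i rfl, hy, neg_zero, zero_add]
  · have := hpv j
    rw [vsub_vadd_eq_vsub_sub, sub_neg_eq_add]
    simp only [map_add] at this ⊢
    linarith [facetCone_nonneg hv j]

theorem oppositePanel_nonempty (𝔸 : ModelApartment V P ι) (w : V ≃ₗ[ℝ] V) (i : ι) :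
    (𝔸.oppositePanel w i).Nonempty :=
  let ⟨v, hv⟩ := 𝔸.facetCone_simple_nonempty w {i}
  ⟨-v, neg_mem_facetCone.2 hv⟩

theorem isSolidChimneyGerm_oppositePanel (hw : w ∈ 𝔸.weylGroup) {w' : V ≃ₗ[ℝ] V}
    (hw' : w' ∈ 𝔸.weylGroup) (i : ι) (x : P) : 𝔸.IsSolidChimneyGerm
      (𝔸.chimneyGerm (𝔸.facet x (𝔸.chamber w')) (𝔸.oppositePanel w i)) :=
  ⟨x, _, _, ⟨∅, 𝔸.isFacetOfType_facetCone hw' ∅⟩, ⟨{i}, 𝔸.isFacetOfType_facetCone_neg hw {i}⟩,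
    isSolid_chimney (𝔸.oppositePanel_nonempty w i) x, rfl⟩

theorem simple_vadd_vsub_of_mem_closure {ξ : V} (hξ : ξ ∈ closure (𝔸.oppositePanel w i)) (v : V)
    (x : P) : 𝔸.simple w i ((v +ᵥ (ξ +ᵥ x)) -ᵥ m) = 𝔸.simple w i (x -ᵥ m) + 𝔸.simple w i v := by
  have hξ0 : 𝔸.simple w i ξ = 0 := by
    simpa using (closure_facetCone_subset hξ).1 i rfl
  rw [vadd_vsub_assoc, vadd_vsub_assoc, map_add, map_add, hξ0, zero_add, add_comm]

end TruncatedCone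

end ModelApartment

/-! ### Charts and retractions -/

namespace ApartmentSystem

variable {V : Type*} [NormedAddCommGroup V] [NormedSpace ℝ V]
  {P : Type*} [AddTorsor V P] {ι : Type*} [Fintype ι] {𝔸 : ModelApartment V P ι}
  {X : Type*} {S : ApartmentSystem 𝔸 X} {A A' : Set X} {f g : P → X}

section Chart

variable (S) in
/-- `f` is an isomorphism from the model onto some apartment, which is then the range of `f`.
Apartments are handled below as ranges of charts. -/
def IsChart (f : P → X) : Prop := ∃ A ∈ S.apartments, f ∈ S.isom A

theorem range_eq_of_mem_isom (hA : A ∈ S.apartments) (hf : f ∈ S.isom A) : Set.range f = A := by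
  rw [← Set.image_univ, (S.isom_bijOn A hA f hf).image_eq]

theorem exists_isChart_range_eq (hA : A ∈ S.apartments) : ∃ f, S.IsChart f ∧ Set.range f = A := by
  obtain ⟨f, hf⟩ := S.isom_nonempty A hA
  exact ⟨f, ⟨A, hA, hf⟩, range_eq_of_mem_isom hA hf⟩

theorem IsChart.range_mem (hf : S.IsChart f) : Set.range f ∈ S.apartments := by
  obtain ⟨A, hA, hfA⟩ := hf
  rwa [range_eq_of_mem_isom hA hfA]

theorem IsChart.mem_isom (hf : S.IsChart f) : f ∈ S.isom (Set.range f) := by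
  obtain ⟨A, hA, hfA⟩ := hf
  rwa [range_eq_of_mem_isom hA hfA]

theorem IsChart.injective (hf : S.IsChart f) : Function.Injective f :=
  Set.injOn_univ.1 (S.isom_bijOn _ hf.range_mem f hf.mem_isom).injOn

theorem IsChart.exists_eq_comp (hf : S.IsChart f) (hg : S.IsChart g)
    (h : Set.range g = Set.range f) : ∃ u ∈ 𝔸.weyl, g = f ∘ u :=
  (S.isom_iff _ hf.range_mem f hf.mem_isom g).1 (h ▸ hg.mem_isom)

theorem IsIso.comp_mem_isom (hA : A ∈ S.apartments) (hA' : A' ∈ S.apartments) {φ : X → X}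
    (hφ : S.IsIso A A' φ) (hf : f ∈ S.isom A) : φ ∘ f ∈ S.isom A' := by
  obtain ⟨g, hg, hφg⟩ := hφ
  obtain ⟨u, hu, rfl⟩ := (S.isom_iff A hA g hg f).1 hf
  exact (S.isom_iff A' hA' _ hφg _).2 ⟨u, hu, rfl⟩

theorem exists_isIso_of_eventuallyEq (hf : S.IsChart f) (hg : S.IsChart g) {G : Filter P}
    (hfg : f =ᶠ[G] g) : ∃ φ, S.IsIso (Set.range g) (Set.range f) φ ∧
      (∀ᶠ y in map f G, φ y = y) ∧ ∀ p, φ (g p) = f p := by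
  have happly : ∀ p, Function.extend g f id (g p) = f p := hg.injective.extend_apply f id
  refine ⟨Function.extend g f id, ⟨g, hg.mem_isom, ?_⟩, ?_, happly⟩
  · rw [Function.extend_comp hg.injective]
    exact hf.mem_isom
  · rw [eventually_map]
    filter_upwards [hfg] with p hp
    nth_rewrite 1 [hp]
    exact happly p

end Chart

namespace IsAffineHovel

variable (hS : S.IsAffineHovel)
include hS

/-- (MA3) and (MA4) are about facets rather than points: this lets them apply to a point. -/
theorem exists_isFacet_of_point (x : X) :
    ∃ F : Filter X, S.Is 𝔸.IsFacet F ∧ pure x ≤ F ∧ ∀ A ∈ S.apartments, x ∈ A → A ∈ F := by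
  obtain ⟨A, hA, hx⟩ : x ∈ ⋃₀ S.apartments := S.cover ▸ Set.mem_univ x
  obtain ⟨f, hf, rfl⟩ := exists_isChart_range_eq hA
  obtain ⟨p, rfl⟩ := hx
  refine ⟨map f (𝔸.facet p (𝔸.stdFacet Set.univ)), ⟨_, hA, f, hf.mem_isom, _,
    ⟨p, _, ⟨Set.univ, Or.inl ⟨1, one_mem _, by simp⟩⟩, rfl⟩, rfl⟩, ?_, fun A' hA' hp => ?_⟩
  · rw [← map_pure]
    exact map_mono (ModelApartment.pure_le_facet_stdFacet_univ p)
  · have h := (hS.ma2 _ hA A' hA' (pure (f p))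
      (Or.inl ⟨f, hf.mem_isom, pure p, ⟨p, rfl⟩, (map_pure f p).symm⟩) hp f hf.mem_isom).1
    rw [← map_pure, comap_map hf.injective] at h
    exact map_mono (ModelApartment.facet_stdFacet_univ_le p)
      (mem_of_superset h Set.inter_subset_right)

section SplayedChimneyGerm

variable (hf : S.IsChart f) (hg : S.IsChart g) {G : Filter P} (hG : 𝔸.IsSplayedChimneyGerm G)
include hf hg hG

theorem enclosureShared_of_point (hgG : ∀ᶠ q in G, f q ∈ Set.range g) {p : P}
    (hp : f p ∈ Set.range g) :
    (∃ T ∈ G, p ∈ T ∧ 𝔸.IsInter 𝔸.closedHalves T ∧ ∀ q ∈ T, f q ∈ Set.range g) ∧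
      ∃ h, S.IsChart h ∧ Set.range h = Set.range g ∧ f =ᶠ[G] h ∧ f p = h p := by
  obtain ⟨F, hF, hpF, hFA⟩ := hS.exists_isFacet_of_point (f p)
  obtain ⟨hrange, φ, hφ, hfix⟩ := hS.ma4 (map f G) F ⟨_, hf.range_mem, f, hf.mem_isom, G, hG, rfl⟩
    (Or.inl hF) _ hf.range_mem _ hg.range_mem range_mem_map (hFA _ hf.range_mem ⟨p, rfl⟩) hgG
    (hFA _ hg.range_mem hp) f hf.mem_isom
  have hle : G ⊔ pure p ≤ comap f (map f G ⊔ F) := by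
    rw [← map_le_iff_le_comap, map_sup, map_pure]
    exact sup_le_sup_left hpF _
  constructor
  · obtain ⟨T, hT, hi, hTS⟩ := hrange
    exact ⟨T, (hle hT).1, (hle hT).2, hi, fun q hq => (hTS hq).2⟩
  · have hφf := hφ.comp_mem_isom hf.range_mem hg.range_mem hf.mem_isom
    obtain ⟨hφG, hφp⟩ := (hle.trans (ModelApartment.le_enclosure _)) (eventually_map.1 hfix)
    exact ⟨φ ∘ f, ⟨_, hg.range_mem, hφf⟩, range_eq_of_mem_isom hg.range_mem hφf,
      Eventually.mono hφG fun _ h => h.symm, Eq.symm hφp⟩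

theorem exists_isChart_eventuallyEq (hgG : ∀ᶠ q in G, f q ∈ Set.range g) :
    ∃ h, S.IsChart h ∧ Set.range h = Set.range g ∧ f =ᶠ[G] h := by
  rcases G.eq_or_neBot with rfl | _
  · exact ⟨g, hg, rfl, eventually_bot⟩
  · obtain ⟨p, hp⟩ := hgG.exists
    obtain ⟨-, h, hh, hrange, hfh, -⟩ := hS.enclosureShared_of_point hf hg hG hgG hp
    exact ⟨h, hh, hrange, hfh⟩

variable (hGs : ModelApartment.support G = ⊤) (hfg : f =ᶠ[G] g)
include hGs hfg

theorem eq_of_apply_eq {p q : P} (hpq : f p = g q) : p = q := by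
  obtain ⟨-, h, hh, hrange, hfh, hp⟩ := hS.enclosureShared_of_point hf hg hG
    (hfg.mono fun r hr => ⟨r, hr.symm⟩) ⟨q, hpq.symm⟩
  obtain ⟨u, -, rfl⟩ := hg.exists_eq_comp hh hrange
  have hu : u = 1 := ModelApartment.eq_one_of_eventually_apply_eq hGs <|
    (hfh.symm.trans hfg).mono fun r hr => hg.injective hr
  subst hu
  exact hg.injective (hp.symm.trans hpq)

theorem apply_eq_of_mem_range {p : P} (hp : f p ∈ Set.range g) : f p = g p := by
  obtain ⟨q, hq⟩ := hp
  rw [← hq, hS.eq_of_apply_eq hf hg hG hGs hfg hq.symm]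

theorem eq_of_range_eq (h : Set.range f = Set.range g) : f = g :=
  funext fun p => hS.apply_eq_of_mem_range hf hg hG hGs hfg (h ▸ ⟨p, rfl⟩)

end SplayedChimneyGerm

theorem exists_isChart_pair (hf : S.IsChart f) (hg : S.IsChart g) {R G : Filter P}
    (hR : 𝔸.IsSplayedChimneyGerm R) (hG : 𝔸.IsSplayedChimneyGerm G)
    (hG' : 𝔸.IsSolidChimneyGerm G) :
    ∃ f' g', S.IsChart f' ∧ S.IsChart g' ∧ Set.range g' = Set.range f' ∧ f =ᶠ[R] f' ∧
      g =ᶠ[G] g' := by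
  obtain ⟨B, hB, hBR, hBG⟩ := hS.ma3 (map f R) (map g G)
    ⟨_, hf.range_mem, f, hf.mem_isom, R, hR, rfl⟩
    (Or.inr ⟨_, hg.range_mem, g, hg.mem_isom, G, hG', rfl⟩)
  obtain ⟨h, hh, rfl⟩ := exists_isChart_range_eq hB
  obtain ⟨f', hf', hff', hfR⟩ := hS.exists_isChart_eventuallyEq hf hh hR hBR
  obtain ⟨g', hg', hgg', hgG⟩ := hS.exists_isChart_eventuallyEq hg hh hG hBG
  exact ⟨f', g', hf', hg', hgg'.trans hff'.symm, hfR, hgG⟩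

section Retraction

variable (hf : S.IsChart f) {G : Filter P} (hG : 𝔸.IsSplayedChimneyGerm G)
include hf hG

theorem exists_isChart_through (x : X) : ∃ g, S.IsChart g ∧ f =ᶠ[G] g ∧ x ∈ Set.range g := by
  obtain ⟨F, hF, hxF, -⟩ := hS.exists_isFacet_of_point x
  obtain ⟨B, hB, hBG, hBF⟩ := hS.ma3 (map f G) F ⟨_, hf.range_mem, f, hf.mem_isom, G, hG, rfl⟩
    (Or.inl hF)
  obtain ⟨g, hg, rfl⟩ := exists_isChart_range_eq hB
  obtain ⟨h, hh, hrange, hfh⟩ := hS.exists_isChart_eventuallyEq hf hg hG hBG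
  exact ⟨h, hh, hfh, hrange ▸ hxF hBF⟩

theorem exists_isRetraction (hGs : ModelApartment.support G = ⊤) :
    ∃ ρ, S.IsRetraction (Set.range f) (map f G) ρ := by
  choose g hg hfg p hp using hS.exists_isChart_through hf hG
  refine ⟨fun x => f (p x), fun x => ⟨p x, rfl⟩, ?_, fun x => ?_, fun x B hB hxB hBG φ hφ hφG => ?_⟩
  · rintro _ ⟨q, rfl⟩
    exact congrArg f (hS.eq_of_apply_eq hf (hg _) hG hGs (hfg _) (hp (f q)).symm).symm
  · obtain ⟨φ, hφ, hφG, -⟩ := exists_isIso_of_eventuallyEq hf (hg x) (hfg x)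
    exact ⟨_, (hg x).range_mem, ⟨p x, hp x⟩, (hfg x).mono fun q hq => ⟨q, hq.symm⟩, φ, hφ, hφG⟩
  · obtain ⟨h, hh, rfl⟩ := exists_isChart_range_eq hB
    obtain ⟨h', hh', hrange, hfh'⟩ := hS.exists_isChart_eventuallyEq hf hh hG hBG
    obtain ⟨q, rfl⟩ : x ∈ Set.range h' := hrange ▸ hxB
    have hq : p (h' q) = q := hS.eq_of_apply_eq (hg _) hh' hG hGs ((hfg _).symm.trans hfh') (hp _)
    have hφh' : φ ∘ h' ∈ S.isom (Set.range f) :=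
      hφ.comp_mem_isom hB hf.range_mem (hrange ▸ hh'.mem_isom)
    have heq : f = φ ∘ h' := by
      refine hS.eq_of_range_eq hf ⟨_, hf.range_mem, hφh'⟩ hG hGs ?_
        (range_eq_of_mem_isom hf.range_mem hφh').symm
      filter_upwards [hfh', eventually_map.1 hφG] with r hr hφr
      rw [Function.comp_apply, ← hr, hφr]
    change f (p (h' q)) = φ (h' q)
    rw [hq, heq, Function.comp_apply]

end Retraction

section Sector

variable [FiniteDimensional ℝ V] {w : V ≃ₗ[ℝ] V} (hf : S.IsChart f) (hg : S.IsChart g)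
  (hw : w ∈ 𝔸.weylGroup) (hfg : f =ᶠ[ModelApartment.sectorGerm (𝔸.chamber w)] g)
include hf hg hw hfg

theorem apply_eq_of_sector {p q : P} (hp : f p ∈ Set.range g)
    (hpq : ∀ j, 0 ≤ 𝔸.simple w j (q -ᵥ p)) : f q = g q := by
  have hG := ModelApartment.isSplayedChimneyGerm_sectorGerm hw
  obtain ⟨⟨T, hTG, hpT, hT, hTg⟩, -⟩ := hS.enclosureShared_of_point hf hg hG
    (hfg.mono fun r hr => ⟨r, hr.symm⟩) hp
  exact hS.apply_eq_of_mem_range hf hg hG (ModelApartment.support_sectorGerm w) hfg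
    (hTg q (hT.mem_of_mem_sectorGerm hTG hpT hpq))

end Sector

end IsAffineHovel

theorem IsRetraction.apply_of_eventuallyEq (hf : S.IsChart f) (hg : S.IsChart g) {G : Filter P}
    (hfg : f =ᶠ[G] g) {ρ : X → X} (hρ : S.IsRetraction (Set.range f) (map f G) ρ) (p : P) :
    ρ (g p) = f p := by
  obtain ⟨φ, hφ, hφG, happly⟩ := exists_isIso_of_eventuallyEq hf hg hfg
  rw [hρ.eq_iso (g p) _ hg.range_mem ⟨p, rfl⟩ (hfg.mono fun q hq => ⟨q, hq.symm⟩) φ hφ hφG,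
    happly]

/-! ### Folding along a wall -/

variable {f₁ f₂ h h' : P → X} {w w' : V ≃ₗ[ℝ] V} {i : ι} {m : P}
  {t : ℝ}

variable (S) in
/-- Seen from the sector germ of direction `w rᵢ C` in the chart `f₁`, the part
`truncatedCone w i m t` of the chart `f₂` is folded onto the other side of the wall through `m`:
some chart `g` extending the germ of `f₁` is equal to `f₂` there, up to the reflection in the
wall. -/
def Folded (f₁ f₂ : P → X) (w : V ≃ₗ[ℝ] V) (i : ι) (m : P) (t : ℝ) : Prop :=
  ∃ g, S.IsChart g ∧ f₁ =ᶠ[ModelApartment.sectorGerm (𝔸.chamber (w * 𝔸.refl i))] g ∧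
    ∀ p ∈ 𝔸.truncatedCone w i m t, f₂ p = g (𝔸.wallRefl w i m p)

theorem isUpperSet_folded : IsUpperSet {t | S.Folded f₁ f₂ w i m t} := by
  rintro t t' htt' ⟨g, hg, hfg, hrefl⟩
  exact ⟨g, hg, hfg, fun p hp => hrefl p ⟨hp.1, htt'.trans hp.2⟩⟩

namespace IsAffineHovel

variable [FiniteDimensional ℝ V] (hS : S.IsAffineHovel)
include hS

theorem exists_isChart_eqOn_closedHalf (hw : w ∈ 𝔸.weylGroup) (hf : S.IsChart f)
    (hA : A ∈ S.apartments) (hfA : Set.MapsTo f (closedHalf (𝔸.simple w i) m) A) :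
    ∃ g, S.IsChart g ∧ Set.range g = A ∧ Set.EqOn f g (closedHalf (𝔸.simple w i) m) := by
  have hG := ModelApartment.isSplayedChimneyGerm_sectorGerm hw
  have hhalf : ∀ v ∈ 𝔸.chamber w, v +ᵥ m ∈ closedHalf (𝔸.simple w i) m := fun v hv => by
    simpa [closedHalf] using facetCone_nonneg hv i
  obtain ⟨h, hh, rfl⟩ := exists_isChart_range_eq hA
  obtain ⟨g, hg, hrange, hfg⟩ := hS.exists_isChart_eventuallyEq hf hh hG <|
    ModelApartment.mem_sectorGerm_chamber.2 ⟨m, fun v hv => hfA (hhalf v hv)⟩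
  exact ⟨g, hg, hrange, fun p hp => hS.apply_eq_of_mem_range hf hg hG
    (ModelApartment.support_sectorGerm w) hfg (hrange ▸ hfA hp)⟩

theorem exists_isChart_apply_eq_iff {A₁ A₂ : Set X} (hA₁ : A₁ ∈ S.apartments)
    (hA₂ : A₂ ∈ S.apartments) (hD : S.IsHalfApartment (A₁ ∩ A₂)) :
    ∃ f₁ f₂, S.IsChart f₁ ∧ S.IsChart f₂ ∧ Set.range f₁ = A₁ ∧ Set.range f₂ = A₂ ∧
      ∃ w ∈ 𝔸.weylGroup, ∃ (i : ι) (m : P), ∀ p, f₁ p = f₂ p ↔ 0 ≤ 𝔸.simple w i (p -ᵥ m) := by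
  obtain ⟨A, hA, f, hf, _, ⟨_, ⟨w, hw, i, rfl⟩, m, -, rfl⟩, hD⟩ := hD
  have hmaps : Set.MapsTo f (closedHalf (𝔸.simple w i) m) (A₁ ∩ A₂) := hD ▸ Set.mapsTo_image _ _
  obtain ⟨f₁, hf₁, rfl, heq₁⟩ := hS.exists_isChart_eqOn_closedHalf hw ⟨A, hA, hf⟩ hA₁
    (hmaps.mono_right Set.inter_subset_left)
  obtain ⟨f₂, hf₂, rfl, heq₂⟩ := hS.exists_isChart_eqOn_closedHalf hw ⟨A, hA, hf⟩ hA₂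
    (hmaps.mono_right Set.inter_subset_right)
  refine ⟨f₁, f₂, hf₁, hf₂, rfl, rfl, w, hw, i, m, fun p => ⟨fun h => ?_, fun hp => ?_⟩⟩
  · obtain ⟨q, hq, hqp⟩ := hD.le ⟨⟨p, rfl⟩, p, h.symm⟩
    exact hf₁.injective ((heq₁ hq).symm.trans hqp) ▸ hq
  · exact (heq₁ hp).symm.trans (heq₂ hp)

variable (hw : w ∈ 𝔸.weylGroup)
include hw

theorem mem_range_of_folded (ht : t ≤ 0) (hfold : S.Folded f₁ f₂ w i m t) (hh : S.IsChart h)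
    (hfh : f₁ =ᶠ[ModelApartment.sectorGerm (𝔸.chamber (w * 𝔸.refl i))] h) {y : P}
    (hyt : 𝔸.simple w i (y -ᵥ m) = t)
    (hy : ∀ v ∈ 𝔸.oppositePanel w i, f₂ (v +ᵥ y) ∈ Set.range h) {p : P}
    (hp : p ∈ 𝔸.truncatedCone w i m t) : f₂ p ∈ Set.range h := by
  obtain ⟨g, hg, hfg, hrefl⟩ := hfold
  obtain ⟨v, hv, hvy, hpv⟩ :=
    ModelApartment.exists_oppositePanel_vadd_mem_truncatedCone ht hyt hp
  have hgv : g (𝔸.wallRefl w i m (v +ᵥ y)) ∈ Set.range h := hrefl _ hvy ▸ hy v hv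
  have hgp : g (𝔸.wallRefl w i m p) = h (𝔸.wallRefl w i m p) :=
    hS.apply_eq_of_sector hg hh (mul_mem hw (𝔸.refl_mem i)) (hfg.symm.trans hfh) hgv fun j => by
      rw [ModelApartment.simple_wallRefl]
      exact hpv j
  exact ⟨_, (hrefl p hp ▸ hgp).symm⟩

theorem eventually_mem_range_of_chimneyGerm (hf₂ : S.IsChart f₂) (hh : S.IsChart h)
    (hw' : w' ∈ 𝔸.weylGroup) {c : V} (hc : c ∈ 𝔸.chamber w') {x : P}
    (hG : ∀ᶠ q in 𝔸.chimneyGerm (𝔸.facet x (𝔸.chamber w')) (𝔸.oppositePanel w i),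
      f₂ q ∈ Set.range h) (hm : f₂ m ∈ Set.range h) :
    ∀ᶠ s in 𝓝[≥] (0 : ℝ), ∀ p ∈ 𝔸.truncatedCone w i m
      (𝔸.simple w i (x -ᵥ m) + s * 𝔸.simple w i c), f₂ p ∈ Set.range h := by
  obtain ⟨⟨T, hTG, hmT, hT, hTh⟩, -⟩ := hS.enclosureShared_of_point hf₂ hh
    (ModelApartment.isSplayedChimneyGerm_oppositePanel hw hw' i x) hG hm
  obtain ⟨ξ, hξ, hev⟩ := ModelApartment.exists_eventually_vadd_mem_of_mem_chimneyGerm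
    (𝔸.oppositePanel_nonempty w i) hTG hc
  filter_upwards [hev] with s hs p hp
  refine hTh p (hT.mem_of_oppositePanel hw hs hmT hp.1 ?_)
  rw [← vsub_sub_vsub_cancel_right p _ m, map_sub,
    ModelApartment.simple_vadd_vsub_of_mem_closure hξ, map_smul, smul_eq_mul]
  exact sub_nonneg.2 hp.2

section HalfApartment

variable (hf₁ : S.IsChart f₁) (hiff : ∀ p, f₁ p = f₂ p ↔ 0 ≤ 𝔸.simple w i (p -ᵥ m))
include hf₁ hiff

section

variable (ht : t < 0) (hh : S.IsChart h)
  (hfh : f₁ =ᶠ[ModelApartment.sectorGerm (𝔸.chamber (w * 𝔸.refl i))] h)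
include ht hh hfh

theorem not_eqOn_truncatedCone : ¬Set.EqOn f₂ h (𝔸.truncatedCone w i m t) := by
  intro heq
  obtain ⟨q, hq, hqt⟩ := 𝔸.exists_mem_truncatedCone_simple_eq w i m ht.le
  obtain ⟨v, hv, hqv⟩ := exists_mem_facetCone_add_nonneg
    (𝔸.facetCone_simple_nonempty (w * 𝔸.refl i) {i}) (u := q -ᵥ m) <| by
      rintro _ rfl
      rw [𝔸.simple_mul_refl_self, LinearMap.neg_apply, hqt]
      exact (neg_pos.2 ht).le
  replace hv : v ∈ 𝔸.panel w i := 𝔸.panel_mul_refl w i ▸ hv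
  have hwall : f₁ (-v +ᵥ m) = f₂ (-v +ᵥ m) := (hiff _).2 (by simp [hv.1 i rfl])
  have hmem : f₁ (-v +ᵥ m) ∈ Set.range h :=
    ⟨_, (hwall.trans (heq (ModelApartment.neg_vadd_mem_truncatedCone ht.le hv))).symm⟩
  have hfq : f₁ q = h q :=
    hS.apply_eq_of_sector hf₁ hh (mul_mem hw (𝔸.refl_mem i)) hfh hmem fun j => by
      rw [vsub_vadd_eq_vsub_sub, sub_neg_eq_add]
      exact hqv j
  exact ht.not_ge (hqt ▸ (hiff q).1 (hfq.trans (heq hq).symm))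

theorem folded_of_eqOn (hh' : S.IsChart h') (hrange : Set.range h' = Set.range h)
    (heq : Set.EqOn f₂ h' (𝔸.truncatedCone w i m t)) : S.Folded f₁ f₂ w i m t := by
  have hw' := mul_mem hw (𝔸.refl_mem i)
  obtain ⟨u, hu, rfl⟩ := hh.exists_eq_comp hh' hrange
  have hfix : ∀ p ∈ 𝔸.truncatedCone w i m t, 𝔸.simple w i (p -ᵥ m) = 0 → u p = p := by
    intro p hp hp0
    have hfp : f₁ p = h (u p) := ((hiff p).2 hp0.ge).trans (heq hp)
    exact hh.injective (hfp.symm.trans (hS.apply_eq_of_mem_range hf₁ hh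
      (ModelApartment.isSplayedChimneyGerm_sectorGerm hw') (ModelApartment.support_sectorGerm _)
      hfh ⟨_, hfp.symm⟩))
  obtain ⟨v, hv⟩ := 𝔸.facetCone_simple_nonempty w {i}
  have hum : u m = m := hfix m (ModelApartment.self_mem_truncatedCone ht.le) (by simp)
  have huv : u.linear v = v := by
    have := hfix _ (ModelApartment.neg_vadd_mem_truncatedCone ht.le hv) (by simp [hv.1 i rfl])
    rw [u.map_vadd, hum] at this
    simpa using vadd_right_cancel m this
  rcases 𝔸.eq_one_or_eq_wallRefl hw hu hum hv huv with rfl | rfl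
  · exact absurd heq (hS.not_eqOn_truncatedCone hw hf₁ hiff ht hh hfh)
  · exact ⟨h, hh, hfh, heq⟩

end

variable (hf₂ : S.IsChart f₂)
include hf₂

/-- Every member of the germ of the chimney whose base is a facet of direction `w' C` at level `t`
contains rays at all levels `t + s * w αᵢ c` for small `s ≥ 0`. Folding at one of these levels puts
`f₂ m` into an apartment containing the sector germ and the chimney germ, and (MA4) then applies to
this apartment. -/
theorem eventually_folded (hw' : w' ∈ 𝔸.weylGroup) {c : V} (hc : c ∈ 𝔸.chamber w') (ht : t ≤ 0)
    (hfreq : ∃ᶠ s in 𝓝[≥] (0 : ℝ), t + s * 𝔸.simple w i c ≤ 0 ∧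
      S.Folded f₁ f₂ w i m (t + s * 𝔸.simple w i c)) :
    ∀ᶠ s in 𝓝[≥] (0 : ℝ), t + s * 𝔸.simple w i c < 0 →
      S.Folded f₁ f₂ w i m (t + s * 𝔸.simple w i c) := by
  obtain ⟨x, -, hxt⟩ := 𝔸.exists_mem_truncatedCone_simple_eq w i m ht
  have hG := ModelApartment.isSplayedChimneyGerm_oppositePanel hw hw' i x
  obtain ⟨h, h', hh, hh', hrange, hfh, hfh'⟩ := hS.exists_isChart_pair hf₁ hf₂
    (ModelApartment.isSplayedChimneyGerm_sectorGerm (mul_mem hw (𝔸.refl_mem i))) hG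
    (ModelApartment.isSolidChimneyGerm_oppositePanel hw hw' i x)
  have hGh : ∀ᶠ q in 𝔸.chimneyGerm (𝔸.facet x (𝔸.chamber w')) (𝔸.oppositePanel w i),
      f₂ q ∈ Set.range h := hfh'.mono fun q hq => hrange ▸ ⟨q, hq.symm⟩
  have hm : f₂ m ∈ Set.range h := by
    obtain ⟨ξ, hξ, hev⟩ := ModelApartment.exists_eventually_vadd_mem_of_mem_chimneyGerm
      (𝔸.oppositePanel_nonempty w i) hGh hc
    obtain ⟨s, ⟨hs, hfold⟩, hys⟩ := (hfreq.and_eventually hev).exists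
    refine hS.mem_range_of_folded hw hs hfold hh hfh ?_ hys
      (ModelApartment.self_mem_truncatedCone hs)
    rw [ModelApartment.simple_vadd_vsub_of_mem_closure hξ, hxt, map_smul, smul_eq_mul]
  filter_upwards [hS.eventually_mem_range_of_chimneyGerm hw hf₂ hh hw' hc hGh hm] with s hs hlt
  rw [hxt] at hs
  exact hS.folded_of_eqOn hw hf₁ hiff hlt hh hfh hh' hrange fun p hp =>
    hS.apply_eq_of_mem_range hf₂ hh' hG
      (ModelApartment.support_chimneyGerm (𝔸.oppositePanel_nonempty w i) x) hfh'
      (hrange ▸ hs p hp)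

theorem folded_of_forall_gt (ht : t < 0) (hfold : ∀ s > t, S.Folded f₁ f₂ w i m s) :
    S.Folded f₁ f₂ w i m t := by
  obtain ⟨c, hc⟩ := 𝔸.facetCone_simple_nonempty w ∅
  have hlt : ∀ᶠ s in 𝓝[≥] (0 : ℝ), t + s * 𝔸.simple w i c < 0 := by
    have : Tendsto (fun s => t + s * 𝔸.simple w i c) (𝓝 0) (𝓝 (t + 0 * 𝔸.simple w i c)) :=
      Continuous.tendsto (by fun_prop) 0
    exact (this.mono_left nhdsWithin_le_nhds).eventually_lt_const (by simpa using ht)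
  have hpos : ∃ᶠ s in 𝓝[≥] (0 : ℝ), s ∈ Set.Ioi 0 :=
    eventually_mem_nhdsWithin.frequently.filter_mono
      (nhdsWithin_mono 0 Set.Ioi_subset_Ici_self)
  have hev := hS.eventually_folded hw hf₁ hiff hf₂ hw hc ht.le <|
    (hpos.and_eventually hlt).mono fun s ⟨hs, hlt⟩ =>
      ⟨hlt.le, hfold _ (lt_add_of_pos_right t (mul_pos hs (hc.2 i (Set.notMem_empty i))))⟩
  simpa [ht] using hev.self_of_nhdsWithin Set.self_mem_Ici

theorem exists_lt_folded (ht : t ≤ 0) (hfold : S.Folded f₁ f₂ w i m t) :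
    ∃ s < t, S.Folded f₁ f₂ w i m s := by
  obtain ⟨c, hc⟩ := 𝔸.facetCone_simple_nonempty (w * 𝔸.refl i) ∅
  have hci : 𝔸.simple w i c < 0 := by
    have := hc.2 i (Set.notMem_empty i)
    rwa [𝔸.simple_mul_refl_self, LinearMap.neg_apply, neg_pos] at this
  have hev := hS.eventually_folded hw hf₁ hiff hf₂ (mul_mem hw (𝔸.refl_mem i)) hc ht <|
    (frequently_pure.2 (by simpa using ⟨ht, hfold⟩)).filter_mono
      (pure_le_nhdsWithin Set.self_mem_Ici)
  obtain ⟨s, hs, hs0⟩ := ((hev.filter_mono (nhdsWithin_mono 0 Set.Ioi_subset_Ici_self)).and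
    self_mem_nhdsWithin).exists
  have hlt : t + s * 𝔸.simple w i c < t := add_lt_of_neg_right t (mul_neg_of_pos_of_neg hs0 hci)
  exact ⟨_, hlt, hs (hlt.trans_le ht)⟩

theorem folded (t : ℝ) : S.Folded f₁ f₂ w i m t := by
  have hzero : S.Folded f₁ f₂ w i m 0 := by
    refine ⟨f₁, hf₁, EventuallyEq.rfl, fun p hp => ?_⟩
    have hp0 : 𝔸.simple w i (p -ᵥ m) = 0 := (hp.1 i).antisymm hp.2
    rw [ModelApartment.wallRefl_apply, 𝔸.rootRefl_apply_of_simple_eq_zero hp0, vsub_vadd]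
    exact ((hiff p).2 hp.2).symm
  refine (eq_univ_of_isUpperSet_of_forall_exists_lt isUpperSet_folded ⟨0, hzero⟩
    (fun t ht => ?_) fun t ht => ?_).ge trivial
  · rcases lt_or_ge t 0 with ht0 | ht0
    · exact hS.folded_of_forall_gt hw hf₁ hiff hf₂ ht0 ht
    · exact isUpperSet_folded ht0 hzero
  · rcases le_or_gt t 0 with ht0 | ht0
    · exact hS.exists_lt_folded hw hf₁ hiff hf₂ ht0 ht
    · exact ⟨0, ht0, hzero⟩

theorem exists_isChart_apply_wallRefl {p : P} (hp : 𝔸.simple w i (p -ᵥ m) ≤ 0) :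
    ∃ g, S.IsChart g ∧ f₁ =ᶠ[ModelApartment.sectorGerm (𝔸.chamber (w * 𝔸.refl i))] g ∧
      f₂ p = g (𝔸.wallRefl w i m p) := by
  obtain ⟨v, hv, hpv⟩ := exists_mem_facetCone_add_nonneg (𝔸.facetCone_simple_nonempty w {i})
    (u := m -ᵥ p) <| by
      rintro _ rfl
      rwa [← neg_vsub_eq_vsub_rev, map_neg, neg_nonneg]
  have hvi : 𝔸.simple w i v = 0 := hv.1 i rfl
  have hiff' : ∀ q, f₁ q = f₂ q ↔ 0 ≤ 𝔸.simple w i (q -ᵥ (v +ᵥ m)) := fun q => by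
    rw [hiff, vsub_vadd_eq_vsub_sub, map_sub, hvi, sub_zero]
  obtain ⟨g, hg, hfg, hrefl⟩ := hS.folded hw hf₁ hiff' hf₂ (𝔸.simple w i (p -ᵥ (v +ᵥ m)))
  refine ⟨g, hg, hfg, ?_⟩
  rw [← ModelApartment.wallRefl_vadd_of_simple_eq_zero 𝔸 hvi m]
  refine hrefl p ⟨fun j => ?_, le_rfl⟩
  rw [← neg_vsub_eq_vsub_rev, vadd_vsub_assoc, map_neg, neg_nonpos, add_comm]
  exact hpv j

theorem image_retraction_eq {ρ : X → X} (hρ : S.IsRetraction (Set.range f₁)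
    (map f₁ (ModelApartment.sectorGerm (𝔸.chamber (w * 𝔸.refl i)))) ρ) :
    ρ '' Set.range f₂ = Set.range f₁ ∩ Set.range f₂ := by
  refine Set.Subset.antisymm ?_ fun x ⟨hx₁, hx₂⟩ => ⟨x, hx₂, hρ.eq_self x hx₁⟩
  rintro _ ⟨_, ⟨p, rfl⟩, rfl⟩
  suffices h : ∃ q, 0 ≤ 𝔸.simple w i (q -ᵥ m) ∧ ρ (f₂ p) = f₁ q by
    obtain ⟨q, hq, hρq⟩ := h
    exact ⟨⟨q, hρq.symm⟩, ⟨q, ((hiff q).2 hq).symm.trans hρq.symm⟩⟩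
  rcases le_total 0 (𝔸.simple w i (p -ᵥ m)) with hp | hp
  · exact ⟨p, hp, by rw [← (hiff p).2 hp, hρ.eq_self _ ⟨p, rfl⟩]⟩
  · obtain ⟨g, hg, hfg, hgp⟩ := hS.exists_isChart_apply_wallRefl hw hf₁ hiff hf₂ hp
    refine ⟨𝔸.wallRefl w i m p, ?_, by rw [hgp, hρ.apply_of_eventuallyEq hf₁ hg hfg]⟩
    rwa [ModelApartment.wallRefl_apply, vadd_vsub, 𝔸.simple_rootRefl, neg_nonneg]

end HalfApartment

end IsAffineHovel

end ApartmentSystem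

end Masure

end

theorem proposition4p11 {V : Type*} [NormedAddCommGroup V] [NormedSpace ℝ V]
    [FiniteDimensional ℝ V] {P : Type*} [AddTorsor V P] {ι : Type*} [Fintype ι]
    (𝔸 : Masure.ModelApartment V P ι) {X : Type*} (S : Masure.ApartmentSystem 𝔸 X)
    (hS : S.IsAffineHovel) (A₁ A₂ D : Set X)
    (hA₁ : A₁ ∈ S.apartments) (hA₂ : A₂ ∈ S.apartments)
    (hD : S.IsHalfApartment D) (hAD : A₁ ∩ A₂ = D) :
    ∃ Q : Filter X, S.IsIn 𝔸.IsSectorGerm A₁ Q ∧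
      ∃ ρ : X → X, S.IsRetraction A₁ Q ρ ∧ ρ '' A₂ = D := by
  subst hAD
  obtain ⟨f₁, f₂, hf₁, hf₂, rfl, rfl, w, hw, i, m, hiff⟩ :=
    hS.exists_isChart_apply_eq_iff hA₁ hA₂ hD
  have hw' : w * 𝔸.refl i ∈ 𝔸.weylGroup := mul_mem hw (𝔸.refl_mem i)
  obtain ⟨ρ, hρ⟩ := hS.exists_isRetraction hf₁
    (Masure.ModelApartment.isSplayedChimneyGerm_sectorGerm hw')
    (Masure.ModelApartment.support_sectorGerm _)
  exact ⟨_, ⟨f₁, hf₁.mem_isom, _, Masure.ModelApartment.isSectorGerm_sectorGerm hw', rfl⟩,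
    ρ, hρ, hS.image_retraction_eq hw hf₁ hiff hf₂ hρ⟩
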